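/- Let $\Delta_{K-1}=\{w\in\mathbf R^K: w\ge 0,\ w'\mathbf 1=1\}$, and let $B_2$ be a $K\times(K-1)$ matrix whose columns are orthonormal and orthogonal to $\mathbf 1$. For each sample size $n\ge 1$ let $\mathcal P_n$ be a nonempty set of probability distributions of the data. For $P\in\mathcal P_n$ let $Q_P:\mathbf R^K\to\mathbf R$ be convex and differentiable, with gradient $\varphi_P$, and let $\mathbb W_P=\operatorname{argmin}_{w\in\Delta_{K-1}}Q_P(w)$. Let $\hat\varphi(w)\in\mathbf R^K$ and the symmetric $K\times K$ matrix $\hat V(w)$ be estimators (measurable functions of the data, for each $w \in \Delta_{K-1}$), and let $V_P(w)$ be $K\times K$ matrices. Put $f_P=B_2'\varphi_P$, $\hat f=B_2'\hat\varphi$, $\Omega_P=B_2'V_PB_2$, $\hat\Omega=B_2'\hat VB_2$. Assume that $\Omega_P(w)$ is symmetric positive definite for all $P\in\mathcal P_n$, $w\in\Delta_{K-1}$, and that for every sequence $P_n\in\mathcal P_n$: (i) for every sequence $w_n\in\mathbb W_{P_n}$ and every $t\in\mathbf R^{K-1}$, $P_n\{\Omega_{P_n}^{-1/2}(w_n)\sqrt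 n(\hat f(w_n)-f_{P_n}(w_n))\le t\}\to\Phi(t)$, where $\Phi$ is the distribution function of $N(0,I_{K-1})$ and $\le$ is coordinatewise; (ii) for every sequence $w_n\in\mathbb W_{P_n}$, $\limsup_n\|\Omega_{P_n}(w_n)\|^2<\infty$ and $\liminf_n\lambda_{\min}(\Omega_{P_n}(w_n))>0$, where $\|\cdot\|$ is the Frobenius norm and $\lambda_{\min}$ the smallest eigenvalue; (iii) for every sequence $w_n\in\Delta_{K-1}$ and every $\epsilon>0$, $P_n\{\|\hat\Omega(w_n)-\Omega_{P_n}(w_n)\|>\epsilon\}\to0$. For $w\in\Delta_{K-1}$ with $\hat\Omega(w)$ positive definite, let $\hat\lambda(w)$ minimize $(\hat f(w)-B_2'\lambda)'\hat\Omega^{-1}(w)(\hat f(w)-B_2'\lambda)$ over $\lambda\in\mathbf R^K$ with $\lambda\ge0$ and $w'\lambda=0$; let $T(w)$ be $n$ times the minimum; let $\hat d(w)$ be the number of zero entries of $B_2\hat\Omega^{-1}(w)(\hat f(w)-B_2'\hat\lambda(w))$; and let $\hat c_{1-\alpha}(w)$ be the $1-\alpha$ quantile of the $\chi^2$ distribution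 with $\max\{K-1-\hat d(w),1\}$ degrees of freedom. Let $C_{1-\alpha}$ be the set of those $w\in\Delta_{K-1}$ for which $\hat\Omega(w)$ is positive definite and $T(w)\le\hat c_{1-\alpha}(w)$. Then, for every $\alpha\in(0,1)$, $$\liminf_{n\to\infty}\ \inf_{P\in\mathcal P_n}\ \inf_{w\in\mathbb W_P}P\{w\in C_{1-\alpha}\}\ \ge\ 1-\alpha .$$ -/

import Mathlib

open MeasureTheory ProbabilityTheory Filter Topology
open scoped Matrix ENNReal

namespace SimplexWeight

/-- `B₂` completes the normalised vector of ones to an orthogonal matrix `[𝟏/√K, B₂]`: its `K - 1`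
columns are orthonormal and orthogonal to the vector of ones. -/
def IsComplement {K : ℕ} (B₂ : Matrix (Fin K) (Fin (K - 1)) ℝ) : Prop :=
  B₂ᵀ * B₂ = 1 ∧ B₂ᵀ *ᵥ (fun _ => (1 : ℝ)) = 0

/-- The set of minimisers of `Q` over the simplex. -/
def argminSet {K : ℕ} (Q : (Fin K → ℝ) → ℝ) : Set (Fin K → ℝ) :=
  {w | w ∈ stdSimplex ℝ (Fin K) ∧ IsMinOn Q (stdSimplex ℝ (Fin K)) w}

/-- The gradient of `Q` at `w`, as the vector of partial derivatives. -/
noncomputable def grad {K : ℕ} (Q : (Fin K → ℝ) → ℝ) (w : Fin K → ℝ) : Fin K → ℝ :=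
  fun j => fderiv ℝ Q w (Pi.single j 1)

/-- The law `N(0, I_m)` on `ℝ^m`. -/
noncomputable def stdNormal (m : ℕ) : Measure (Fin m → ℝ) :=
  Measure.pi fun _ => gaussianReal 0 1

/-- The `χ²` distribution with `k` degrees of freedom. -/
noncomputable def chiSq (k : ℕ) : Measure ℝ :=
  (stdNormal k).map fun z => ∑ i, z i ^ 2

/-- The `p`-quantile of the `χ²` distribution with `k` degrees of freedom. -/
noncomputable def chiSqQuantile (k : ℕ) (p : ℝ) : ℝ :=
  sInf {x : ℝ | p ≤ cdf (chiSq k) x}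

/-- The Frobenius norm. -/
noncomputable def frobNorm {m : ℕ} (A : Matrix (Fin m) (Fin m) ℝ) : ℝ :=
  Real.sqrt (Aᵀ * A).trace

/-- The minimum eigenvalue of a symmetric matrix. -/
noncomputable def minEigenvalue {m : ℕ} (A : Matrix (Fin m) (Fin m) ℝ) : EReal :=
  ⨅ μ ∈ spectrum ℝ A, (μ : EReal)

open scoped MatrixOrder in
/-- `Ω^{-1/2}`, the inverse of the positive semidefinite square root. -/
noncomputable def invSqrt {m : ℕ} (Ω : Matrix (Fin m) (Fin m) ℝ) : Matrix (Fin m) (Fin m) ℝ :=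
  (CFC.sqrt Ω)⁻¹

/-- `‖x‖²_Ω = x' Ω⁻¹ x`. -/
noncomputable def sqNorm {m : ℕ} (Ω : Matrix (Fin m) (Fin m) ℝ) (x : Fin m → ℝ) : ℝ :=
  x ⬝ᵥ (Ω⁻¹ *ᵥ x)

/-- The feasible multipliers: `w'λ = 0` and `λ ≥ 0`. -/
def multipliers {K : ℕ} (w : Fin K → ℝ) : Set (Fin K → ℝ) :=
  {l | w ⬝ᵥ l = 0 ∧ 0 ≤ l}

section Procedure

variable {K : ℕ} (B₂ : Matrix (Fin K) (Fin (K - 1)) ℝ)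

/-- Step 1: `l` minimises `‖f - B₂' l‖²_Ω` over the feasible multipliers. -/
def IsMultiplierEstimate (f : Fin (K - 1) → ℝ) (Ω : Matrix (Fin (K - 1)) (Fin (K - 1)) ℝ)
    (w l : Fin K → ℝ) : Prop :=
  l ∈ multipliers w ∧ IsMinOn (fun l' => sqNorm Ω (f - B₂ᵀ *ᵥ l')) (multipliers w) l

/-- Step 2: the number of zeros of the vector `B₂ Ω⁻¹ (f - B₂' l)`. -/
noncomputable def zeroCount (f : Fin (K - 1) → ℝ) (Ω : Matrix (Fin (K - 1)) (Fin (K - 1)) ℝ)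
    (l : Fin K → ℝ) : ℕ :=
  {j : Fin K | (B₂ *ᵥ (Ω⁻¹ *ᵥ (f - B₂ᵀ *ᵥ l))) j = 0}.ncard

/-- Step 3: the `1 - α` quantile of `χ²` with `max {K - 1 - d, 1}` degrees of freedom (truncated
subtraction is harmless under the maximum). -/
noncomputable def criticalValue (α : ℝ) (f : Fin (K - 1) → ℝ)
    (Ω : Matrix (Fin (K - 1)) (Fin (K - 1)) ℝ) (l : Fin K → ℝ) : ℝ :=
  chiSqQuantile (max (K - 1 - zeroCount B₂ f Ω l) 1) (1 - α)

/-- The confidence set at sample size `n`, computed from the functions `w ↦ f̂(w)` and `w ↦ Ω̂(w)`.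
Points `w` at which `Ω̂(w)` is not positive definite, where the procedure is not defined, are left
out of the set. At the other points of the simplex the minimiser exists and is unique. -/
def confidenceSet (n : ℕ) (α : ℝ) (f : (Fin K → ℝ) → Fin (K - 1) → ℝ)
    (Ω : (Fin K → ℝ) → Matrix (Fin (K - 1)) (Fin (K - 1)) ℝ) : Set (Fin K → ℝ) :=
  {w | w ∈ stdSimplex ℝ (Fin K) ∧ (Ω w).PosDef ∧
    ∃ l, IsMultiplierEstimate B₂ (f w) (Ω w) w l ∧
      n * sqNorm (Ω w) (f w - B₂ᵀ *ᵥ l) ≤ criticalValue B₂ α (f w) (Ω w) l}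

/-- Uniform asymptotic normality, uniform nondegeneracy and boundedness of the asymptotic variance,
and uniform consistency of its estimator. Here `X n` is the data space at sample size `n ≥ 1`,
`Model n` the set of data distributions, `Q n P` the population objective, `V n P w` the asymptotic
variance matrix of `φ̂(w)`, and `φ n x w`, `Vhat n x w` are the estimators at data `x`. -/
structure AsymptoticAssumption {X : ℕ → Type*} [∀ n, MeasurableSpace (X n)]
    (Model : ∀ n, Set (Measure (X n)))
    (Q : ∀ n, Measure (X n) → (Fin K → ℝ) → ℝ)
    (V : ∀ n, Measure (X n) → (Fin K → ℝ) → Matrix (Fin K) (Fin K) ℝ)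
    (φ : ∀ n, X n → (Fin K → ℝ) → Fin K → ℝ)
    (Vhat : ∀ n, X n → (Fin K → ℝ) → Matrix (Fin K) (Fin K) ℝ) : Prop where
  posDef : ∀ n, 1 ≤ n → ∀ P ∈ Model n, ∀ w ∈ stdSimplex ℝ (Fin K), (B₂ᵀ * V n P w * B₂).PosDef
  asymptoticNormality : ∀ (P : ∀ n, Measure (X n)) (w : ℕ → Fin K → ℝ),
    (∀ n, 1 ≤ n → P n ∈ Model n ∧ w n ∈ argminSet (Q n (P n))) →
    ∀ t : Fin (K - 1) → ℝ,
      Tendsto (fun n => P n {x | invSqrt (B₂ᵀ * V n (P n) (w n) * B₂) *ᵥ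
          (Real.sqrt n • (B₂ᵀ *ᵥ φ n x (w n) - B₂ᵀ *ᵥ grad (Q n (P n)) (w n))) ≤ t})
        atTop (𝓝 (stdNormal (K - 1) (Set.Iic t)))
  bounded : ∀ (P : ∀ n, Measure (X n)) (w : ℕ → Fin K → ℝ),
    (∀ n, 1 ≤ n → P n ∈ Model n ∧ w n ∈ argminSet (Q n (P n))) →
    limsup (fun n => ((frobNorm (B₂ᵀ * V n (P n) (w n) * B₂) ^ 2 : ℝ) : EReal)) atTop < ⊤
  nondegenerate : ∀ (P : ∀ n, Measure (X n)) (w : ℕ → Fin K → ℝ),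
    (∀ n, 1 ≤ n → P n ∈ Model n ∧ w n ∈ argminSet (Q n (P n))) →
    0 < liminf (fun n => minEigenvalue (B₂ᵀ * V n (P n) (w n) * B₂)) atTop
  consistent : ∀ (P : ∀ n, Measure (X n)) (w : ℕ → Fin K → ℝ),
    (∀ n, 1 ≤ n → P n ∈ Model n ∧ w n ∈ stdSimplex ℝ (Fin K)) →
    ∀ ε : ℝ, 0 < ε →
      Tendsto (fun n => P n {x | ε < frobNorm (B₂ᵀ * Vhat n x (w n) * B₂ -
        B₂ᵀ * V n (P n) (w n) * B₂)}) atTop (𝓝 0)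

end Procedure

end SimplexWeight

/-! The argument is by contradiction: take near-worst `P n` and minimisers `w n`, along an
ultrafilter of sample sizes. The first-order conditions (`lagrange_mem_multipliers`) give `√n f̂ = H
z + B₂' ν`, where `H² = Ω`, `z` is asymptotically standard normal, and the scaled multipliers `ν ≥
0` vanish off the set `J` of zero weights. Thus `T` is the squared `Ω̂`-distance from `√n f̂` to the
cone generated by the rows of `B₂` in `J`.

Limit experiment (`le_stdNormal_iUnion_inRegion`). When the projection to the cone has active set
`A`, the whitened residual is the orthogonal projection to the complement `L` of the rows in `A`,
and `dim L = K - 1 - |A|`. The event that `A` is active splits into negativity of the slacks, which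
confines the residual to a cone in `L`, and positivity of the multipliers, which concerns only the
independent component orthogonal to `L`. The mean `μ` has nonpositive inner product with the
directions `θ` of that cone, so along `θ` the radius `ρ` has the central density times the
decreasing factor `exp (ρ ⟪μ, θ⟫)`: it is stochastically smaller than in the centred case
(`mul_stdGaussian_cone_le`). Hence the test with `K - 1 - |A|` degrees of freedom has conditional
coverage at least `1 - α` given `A`. Almost surely exactly one `A` occurs, with strict
complementarity, so that the zero count is `|A|` (or the residual is zero, if `|A| = K - 1`).
Summation over `A` gives the bound.

Transfer. Along the ultrafilter `J` is constant, `H` converges, and each component of `ν` converges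
or diverges; the divergent ones, indexed by `I`, lose their sign constraint in the limit. Strict
complementarity and `T < c` survive small perturbations (`eventually_inRegion`), so weak convergence
on open sets yields the lower bound (`eventually_lt_measure_of_eventually_nhds`). -/

namespace SimplexWeight

/-! ### Gaussian measure in polar coordinates. -/

section Radial

open scoped RealInnerProductSpace

variable {E : Type*} [NormedAddCommGroup E] [InnerProductSpace ℝ E] [FiniteDimensional ℝ E]
  [MeasurableSpace E] [BorelSpace E]

/-- The standard Gaussian measure has density proportional to `exp (-‖x‖² / 2)`. -/
theorem exists_stdGaussian_eq_withDensity (E : Type*) [NormedAddCommGroup E]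
    [InnerProductSpace ℝ E] [FiniteDimensional ℝ E] [MeasurableSpace E] [BorelSpace E] :
    ∃ c : ℝ, 0 < c ∧ stdGaussian E =
      (volume : Measure E).withDensity fun x => ENNReal.ofReal (c * Real.exp (-‖x‖ ^ 2 / 2)) := by
  -- `C` is the Gaussian integral of `exp (-‖x‖² / 2)`; the two measures are then identified by
  -- their characteristic functions.
  set C : ℝ := (2 * Real.pi) ^ (Module.finrank ℝ E / 2 : ℝ) with hC
  have hCpos : 0 < C := by positivity
  have hCc : ((Real.pi : ℂ) / (1 / 2 : ℂ)) ^ (Module.finrank ℝ E / 2 : ℂ) = (C : ℂ) := by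
    rw [hC, Complex.ofReal_cpow (by positivity)]
    congr 1 <;> push_cast <;> ring
  have hint (t : E) : ∫ v : E, Complex.exp (-(1 / 2 : ℂ) * ‖v‖ ^ 2 + Complex.I * ⟪t, v⟫) =
      C * Complex.exp (-‖t‖ ^ 2 / 2) := by
    rw [GaussianFourier.integral_cexp_neg_mul_sq_norm_add (by norm_num), hCc]
    congr 2
    rw [Complex.I_sq]; ring
  have hfin : Integrable (fun v : E => C⁻¹ * Real.exp (-‖v‖ ^ 2 / 2)) := by
    have := (GaussianFourier.integrable_cexp_neg_mul_sq_norm_add (V := E) (b := 1 / 2)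
      (by norm_num) 0 0).re
    refine (this.const_mul C⁻¹).congr (Eventually.of_forall fun v => ?_)
    simp only [zero_mul, add_zero]
    congr 1
    rw [show (-(1 / 2 : ℂ) * (‖v‖ : ℂ) ^ 2) = ((-‖v‖ ^ 2 / 2 : ℝ) : ℂ) by push_cast; ring]
    exact Complex.exp_ofReal_re _
  have hmeas : Measurable fun x : E => ENNReal.ofReal (C⁻¹ * Real.exp (-‖x‖ ^ 2 / 2)) := by
    fun_prop
  refine ⟨C⁻¹, by positivity, ?_⟩
  have : IsFiniteMeasure ((volume : Measure E).withDensity fun x =>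
      ENNReal.ofReal (C⁻¹ * Real.exp (-‖x‖ ^ 2 / 2))) :=
    isFiniteMeasure_withDensity_ofReal hfin.2
  refine Measure.ext_of_charFun (funext fun t => ?_)
  rw [charFun_stdGaussian, charFun_apply,
    integral_withDensity_eq_integral_toReal_smul hmeas (by simp)]
  have : ∀ x : E, (ENNReal.ofReal (C⁻¹ * Real.exp (-‖x‖ ^ 2 / 2))).toReal •
      Complex.exp (⟪x, t⟫ * Complex.I) =
      (C : ℂ)⁻¹ * Complex.exp (-(1 / 2 : ℂ) * ‖x‖ ^ 2 + Complex.I * ⟪t, x⟫) := by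
    intro x
    rw [ENNReal.toReal_ofReal (by positivity), Complex.real_smul, Complex.exp_add,
      real_inner_comm]
    push_cast
    rw [mul_assoc]
    congr 3
    · ring_nf
    · ring
  simp_rw [this]
  rw [integral_const_mul, hint, ← mul_assoc, inv_mul_cancel₀ (by exact_mod_cast hCpos.ne'), one_mul]

theorem stdGaussian_absolutelyContinuous (E : Type*) [NormedAddCommGroup E]
    [InnerProductSpace ℝ E] [FiniteDimensional ℝ E] [MeasurableSpace E] [BorelSpace E] :
    stdGaussian E ≪ (volume : Measure E) := by
  obtain ⟨c, -, h⟩ := exists_stdGaussian_eq_withDensity E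
  rw [h]
  exact withDensity_absolutelyContinuous _ _

/-- Affine hyperplanes are null sets of the standard Gaussian measure. -/
theorem stdGaussian_hyperplane_eq_zero {a : E} (ha : a ≠ 0) (c : ℝ) :
    stdGaussian E {z | ⟪a, z⟫ = c} = 0 := by
  refine stdGaussian_absolutelyContinuous E ?_
  by_cases hne : ∃ z₀, ⟪a, z₀⟫ = c
  · obtain ⟨z₀, hz₀⟩ := hne
    have h0 : (volume : Measure E) ((innerSL ℝ a).ker : Submodule ℝ E) = 0 := by
      refine Measure.addHaar_submodule _ _ fun h => ha ?_
      have : a ∈ ((innerSL ℝ a).ker : Submodule ℝ E) := by rw [h]; trivial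
      simpa using this
    have h1 := measure_preimage_add_right (volume : Measure E) (-z₀)
      ((innerSL ℝ a).ker : Submodule ℝ E)
    rw [h0] at h1
    refine measure_mono_null (fun z hz => ?_) h1
    simp only [Set.mem_preimage, SetLike.mem_coe, LinearMap.mem_ker, Set.mem_ofPred_eq] at hz ⊢
    simp [inner_add_right, inner_neg_right, hz, hz₀]
  · have : {z : E | ⟪a, z⟫ = c} = ∅ := by
      ext z; simpa using fun h => hne ⟨z, h⟩
    simp [this]

/-- Reweighting a finite measure by a decreasing function increases the relative weight of a
lower set. -/
theorem mul_lintegral_le_setLIntegral_of_antitone {T : Type*} [LinearOrder T] [MeasurableSpace T]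
    (m : Measure T) [IsFiniteMeasure m] {U : Set T} (hU : MeasurableSet U) (hlow : IsLowerSet U)
    {g : T → ℝ≥0∞} (hg : Antitone g) {p : ℝ≥0∞} (hp : p ≤ 1)
    (h : p * m Set.univ ≤ m U) : p * ∫⁻ x, g x ∂m ≤ ∫⁻ x in U, g x ∂m := by
  obtain ⟨p', hp'⟩ := exists_add_of_le hp
  have hpt : p ≠ ∞ := ne_top_of_le_ne_top ENNReal.one_ne_top hp
  -- The level `s` separates the values of `g` on `U` from those off `U`. With `p + p' = 1` the
  -- hypothesis reads `p m(Uᶜ) ≤ p' m(U)`, and multiplying by `s` turns it into `p ∫_{Uᶜ} g ≤ p' ∫_U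
  -- g`.
  set s : ℝ≥0∞ := ⨆ y ∈ Uᶜ, g y
  have hUs : ∀ x ∈ U, s ≤ g x := fun x hx => iSup₂_le fun y hy =>
    hg (le_of_lt (lt_of_not_ge fun hyx => hy (hlow hyx hx)))
  have h1 : s * m U ≤ ∫⁻ x in U, g x ∂m := by
    rw [← setLIntegral_const]
    exact setLIntegral_mono' hU hUs
  have h2 : ∫⁻ x in Uᶜ, g x ∂m ≤ s * m Uᶜ := by
    rw [← setLIntegral_const]
    exact setLIntegral_mono' hU.compl fun x hx => le_iSup₂ (f := fun y _ => g y) x hx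
  have h3 : p * m Uᶜ ≤ p' * m U := by
    have : p * m U + p * m Uᶜ ≤ p * m U + p' * m U := by
      rw [← mul_add, measure_add_measure_compl hU, ← add_mul, ← hp', one_mul]
      exact h
    exact (ENNReal.add_le_add_iff_left (ENNReal.mul_ne_top hpt (measure_ne_top m U))).1 this
  rw [← lintegral_add_compl g hU, mul_add]
  calc p * ∫⁻ x in U, g x ∂m + p * ∫⁻ x in Uᶜ, g x ∂m
      ≤ p * ∫⁻ x in U, g x ∂m + p' * ∫⁻ x in U, g x ∂m := by
        refine add_le_add le_rfl ?_
        calc p * ∫⁻ x in Uᶜ, g x ∂m ≤ p * (s * m Uᶜ) := by gcongr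
          _ = s * (p * m Uᶜ) := by ring
          _ ≤ s * (p' * m U) := by gcongr
          _ = p' * (s * m U) := by ring
          _ ≤ _ := by gcongr
    _ = ∫⁻ x in U, g x ∂m := by rw [← add_mul, ← hp', one_mul]

/-- Integration in polar coordinates. -/
theorem lintegral_eq_lintegral_sphere_lintegral [Nontrivial E] {f : E → ℝ≥0∞}
    (hf : Measurable f) :
    ∫⁻ x, f x = ∫⁻ θ, ∫⁻ ρ, f (ρ.1 • θ.1)
      ∂(Measure.volumeIoiPow (Module.finrank ℝ E - 1)) ∂(volume : Measure E).toSphere := by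
  have h1 : ∫⁻ x, f x = ∫⁻ x : ({0}ᶜ : Set E), f x ∂((volume : Measure E).comap (↑)) := by
    rw [lintegral_subtype_comap (measurableSet_singleton _).compl, restrict_compl_singleton]
  have h2 := (volume : Measure E).measurePreserving_homeomorphUnitSphereProd.lintegral_comp_emb
    (Homeomorph.measurableEmbedding _) (fun q => f (q.2.1 • q.1.1))
  rw [h1, ← lintegral_prod (fun q : Metric.sphere (0 : E) 1 × Set.Ioi (0 : ℝ) =>
    f (q.2.1 • q.1.1)) (by fun_prop), ← h2]
  refine lintegral_congr fun x => ?_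
  congr 1
  simp only [homeomorphUnitSphereProd_apply_snd_coe, homeomorphUnitSphereProd_apply_fst_coe]
  rw [smul_smul, mul_inv_cancel₀ (norm_ne_zero_iff.2 x.2), one_smul]

/-- Among the directions in a cone on which the mean is nonpositive, a shifted standard Gaussian
vector is closer to the origin than a centred one. -/
theorem mul_stdGaussian_cone_le [Nontrivial E] {F : Set E} (hF : MeasurableSet F)
    (hcone : ∀ u ∈ F, ∀ t : ℝ, 0 < t → t • u ∈ F) {μ : E} (hμ : ∀ u ∈ F, ⟪μ, u⟫ ≤ 0) {c : ℝ}
    {p : ℝ≥0∞} (hp : p ≤ stdGaussian E {u | ‖u‖ ^ 2 < c}) :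
    p * stdGaussian E {z | z + μ ∈ F} ≤ stdGaussian E {z | z + μ ∈ F ∧ ‖z + μ‖ ^ 2 < c} := by
  obtain ⟨a, ha, hγ⟩ := exists_stdGaussian_eq_withDensity E
  have hp1 : p ≤ 1 := hp.trans prob_le_one
  set σ := (volume : Measure E).toSphere
  set d := Module.finrank ℝ E - 1
  -- Up to normalisation, `m` is the law of the norm of a centred standard Gaussian vector.
  set m : Measure (Set.Ioi (0 : ℝ)) := (Measure.volumeIoiPow d).withDensity
    fun ρ => ENNReal.ofReal (Real.exp (-ρ.1 ^ 2 / 2)) with hm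
  have hmd : Measurable fun ρ : Set.Ioi (0 : ℝ) => ENNReal.ofReal (Real.exp (-ρ.1 ^ 2 / 2)) := by
    fun_prop
  set U : Set (Set.Ioi (0 : ℝ)) := {ρ | ρ.1 ^ 2 < c} with hUdef
  have hU : MeasurableSet U := measurableSet_lt (by fun_prop) measurable_const
  have hUlow : IsLowerSet U := fun x y hyx hx => by
    have hy : (0 : ℝ) < y.1 := y.2
    have : y.1 ≤ x.1 := hyx
    simp only [hUdef, Set.mem_ofPred_eq] at hx ⊢
    nlinarith
  have hnorm (θ : Metric.sphere (0 : E) 1) (ρ : Set.Ioi (0 : ℝ)) : ‖ρ.1 • θ.1‖ = ρ.1 := by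
    have hρ : (0 : ℝ) < ρ.1 := ρ.2
    rw [norm_smul, Real.norm_of_nonneg hρ.le]
    simp
  have hcent (s : Set ℝ) (hs : MeasurableSet s) : stdGaussian E {u | ‖u‖ ^ 2 ∈ s} =
      ENNReal.ofReal a * σ Set.univ * m {ρ | ρ.1 ^ 2 ∈ s} := by
    have hs' : MeasurableSet {u : E | ‖u‖ ^ 2 ∈ s} := (by fun_prop : Measurable fun u : E =>
      ‖u‖ ^ 2) hs
    have hs'' : MeasurableSet {ρ : Set.Ioi (0 : ℝ) | ρ.1 ^ 2 ∈ s} :=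
      (by fun_prop : Measurable fun ρ : Set.Ioi (0 : ℝ) => ρ.1 ^ 2) hs
    rw [hγ, withDensity_apply _ hs', ← lintegral_indicator hs',
      lintegral_eq_lintegral_sphere_lintegral (Measurable.indicator (by fun_prop) hs')]
    have : ∀ θ : Metric.sphere (0 : E) 1, ∫⁻ ρ, ({u : E | ‖u‖ ^ 2 ∈ s}.indicator
        (fun x => ENNReal.ofReal (a * Real.exp (-‖x‖ ^ 2 / 2)))) (ρ.1 • θ.1)
        ∂(Measure.volumeIoiPow d) = ENNReal.ofReal a * m {ρ | ρ.1 ^ 2 ∈ s} := by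
      intro θ
      rw [hm, withDensity_apply _ hs'', ← lintegral_indicator hs'',
        ← lintegral_const_mul _ (Measurable.indicator hmd hs'')]
      refine lintegral_congr fun ρ => ?_
      by_cases hρ : ρ.1 ^ 2 ∈ s
      · simp [Set.indicator, hnorm, hρ, ENNReal.ofReal_mul ha.le]
      · simp [Set.indicator, hnorm, hρ]
    rw [lintegral_congr this, lintegral_const]
    ring
  have hσ0 : ENNReal.ofReal a * σ Set.univ ≠ 0 := by
    refine mul_ne_zero (by simpa using ha) ?_
    rw [Measure.measure_univ_ne_zero]
    exact Measure.toSphere_ne_zero _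
  have hσt : ENNReal.ofReal a * σ Set.univ ≠ ∞ :=
    ENNReal.mul_ne_top ENNReal.ofReal_ne_top (measure_ne_top _ _)
  have htot := hcent Set.univ .univ
  simp only [Set.mem_univ, Set.ofPred_true, measure_univ] at htot
  have hmfin : IsFiniteMeasure m := ⟨by
    rw [lt_top_iff_ne_top]
    intro h
    rw [h, ENNReal.mul_top hσ0] at htot
    exact ENNReal.one_ne_top htot⟩
  -- The total mass `htot` supplies the normalisation that turns the bound on `p` into a statement
  -- about `m`.
  have hball : p * m Set.univ ≤ m U := by
    have h1 := hcent (Set.Iio c) measurableSet_Iio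
    simp only [Set.mem_Iio] at h1
    rw [h1] at hp
    have h2 : ENNReal.ofReal a * σ Set.univ * (p * m Set.univ) ≤
        ENNReal.ofReal a * σ Set.univ * m U := by
      calc _ = p * (ENNReal.ofReal a * σ Set.univ * m Set.univ) := by ring
        _ = p := by rw [← htot, mul_one]
        _ ≤ _ := hp
    exact (ENNReal.mul_le_mul_iff_right hσ0 hσt).1 h2
  set b : ℝ := a * Real.exp (-‖μ‖ ^ 2 / 2) with hb
  -- Substituting `u = z + μ` and expanding `‖u - μ‖²`, the law along the ray `θ` is `m` reweighted
  -- by `exp (ρ ⟪μ, θ⟫)`.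
  have hshift (s : Set ℝ) (hs : MeasurableSet s) :
      stdGaussian E {z | z + μ ∈ F ∧ ‖z + μ‖ ^ 2 ∈ s} =
      ∫⁻ θ, F.indicator 1 θ.1 * (ENNReal.ofReal b * ∫⁻ ρ in {ρ | ρ.1 ^ 2 ∈ s},
        ENNReal.ofReal (Real.exp (ρ.1 * ⟪μ, θ.1⟫)) ∂m) ∂σ := by
    have hF' : MeasurableSet {u : E | u ∈ F ∧ ‖u‖ ^ 2 ∈ s} :=
      hF.inter ((by fun_prop : Measurable fun u : E => ‖u‖ ^ 2) hs)
    have hs'' : MeasurableSet {ρ : Set.Ioi (0 : ℝ) | ρ.1 ^ 2 ∈ s} :=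
      (by fun_prop : Measurable fun ρ : Set.Ioi (0 : ℝ) => ρ.1 ^ 2) hs
    have hz : MeasurableSet {z : E | z + μ ∈ F ∧ ‖z + μ‖ ^ 2 ∈ s} :=
      measurable_add_const μ hF'
    rw [hγ, withDensity_apply _ hz, ← lintegral_indicator hz,
      ← lintegral_sub_right_eq_self _ μ,
      lintegral_eq_lintegral_sphere_lintegral]
    · refine lintegral_congr fun θ => ?_
      by_cases hθ : θ.1 ∈ F
      · rw [Set.indicator_of_mem hθ, Pi.one_apply, one_mul, hm,
          setLIntegral_withDensity_eq_setLIntegral_mul _ hmd (by fun_prop) hs'',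
          ← lintegral_indicator hs'', ← lintegral_const_mul _
            (Measurable.indicator (by fun_prop) hs'')]
        refine lintegral_congr fun ρ => ?_
        have hρ : ρ.1 • θ.1 ∈ F := hcone _ hθ _ ρ.2
        by_cases hρs : ρ.1 ^ 2 ∈ s
        · rw [Set.indicator_of_mem (by simpa [hnorm, hρ] using hρs),
            Set.indicator_of_mem (by simpa using hρs), Pi.mul_apply,
            ← ENNReal.ofReal_mul (by positivity), ← ENNReal.ofReal_mul (by positivity)]
          congr 1
          rw [hb, mul_assoc, ← Real.exp_add, ← Real.exp_add, norm_sub_sq_real, hnorm,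
            real_inner_smul_left, real_inner_comm]
          congr 2
          ring
        · rw [Set.indicator_of_notMem (by simpa [hnorm, hρ] using hρs),
            Set.indicator_of_notMem (by simpa using hρs), mul_zero]
      · rw [Set.indicator_of_notMem hθ, zero_mul]
        refine (lintegral_congr fun ρ => ?_).trans lintegral_zero
        refine Set.indicator_of_notMem (fun h => hθ ?_) _
        have h' : ρ.1 • θ.1 ∈ F := by simpa using h.1
        have hρ : (0 : ℝ) < ρ.1 := ρ.2
        simpa [smul_smul, inv_mul_cancel₀ hρ.ne'] using hcone _ h' ρ.1⁻¹ (by positivity)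
    · exact (Measurable.indicator (by fun_prop) hz).comp (by fun_prop)
  have hA := hshift Set.univ .univ
  have hB := hshift (Set.Iio c) measurableSet_Iio
  simp only [Set.mem_univ, and_true, Set.ofPred_true, Measure.restrict_univ] at hA
  simp only [Set.mem_Iio] at hB
  rw [hA, hB, ← lintegral_const_mul' _ _ (ne_top_of_le_ne_top ENNReal.one_ne_top hp1)]
  refine lintegral_mono fun θ => ?_
  by_cases hθ : θ.1 ∈ F
  · simp only [Set.indicator_of_mem hθ, Pi.one_apply, one_mul]
    rw [mul_left_comm]
    gcongr
    -- On `F` the inner product with `μ` is nonpositive, so the weight decreases in the radius.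
    refine mul_lintegral_le_setLIntegral_of_antitone m hU hUlow (fun x y hxy => ?_) hp1 hball
    refine ENNReal.ofReal_le_ofReal (Real.exp_le_exp.2 ?_)
    exact mul_le_mul_of_nonpos_right hxy (hμ _ hθ)
  · simp [Set.indicator_of_notMem hθ]

end Radial

/-! ### Independent splitting along a subspace, and `χ²` quantiles. -/

section Splitting

open scoped RealInnerProductSpace

variable {E : Type*} [NormedAddCommGroup E] [InnerProductSpace ℝ E] [FiniteDimensional ℝ E]
  [MeasurableSpace E] [BorelSpace E]

/-- The standard Gaussian characteristic function depends only on the norm, which is the same in `L`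
and in `E`. -/
theorem stdGaussian_map_orthogonalProjection (L : Submodule ℝ E) :
    (stdGaussian E).map L.orthogonalProjectionOnto = stdGaussian L := by
  refine Measure.ext_of_charFun (funext fun t => ?_)
  rw [charFun_stdGaussian, charFun_apply, integral_map (by fun_prop) (by fun_prop)]
  have := charFun_stdGaussian (E := E) t
  rw [charFun_apply] at this
  simp only [Submodule.inner_orthogonalProjectionOnto_eq_of_mem_right, Submodule.coe_norm]
  exact this

/-- The pair is jointly Gaussian, so it is enough that the cross-covariances vanish, and these are
inner products of a vector of `L` with one orthogonal to `L`. -/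
theorem indepFun_orthogonalProjection_sub (L : Submodule ℝ E) :
    IndepFun L.orthogonalProjectionOnto (fun z => z - L.starProjection z) (stdGaussian E) := by
  let T : E →L[ℝ] L × E := L.orthogonalProjectionOnto.prod (ContinuousLinearMap.id ℝ E -
    L.starProjection)
  have hT : HasGaussianLaw (fun z => (L.orthogonalProjectionOnto z, z - L.starProjection z))
      (stdGaussian E) := ⟨by
    change IsGaussian ((stdGaussian E).map T)
    infer_instance⟩
  refine hT.indepFun_of_covariance_inner fun x y => ?_
  have h1 : (fun ω : E => ⟪x, L.orthogonalProjectionOnto ω⟫) = fun ω => ⟪(x : E), ω⟫ := by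
    ext ω
    rw [Submodule.inner_orthogonalProjectionOnto_eq_of_mem_left]
  have h2 : (fun ω : E => ⟪y, ω - L.starProjection ω⟫) = fun ω => ⟪y - L.starProjection y, ω⟫ := by
    ext ω
    rw [inner_sub_left, inner_sub_right, Submodule.inner_starProjection_left_eq_right]
  rw [h1, h2, ← covarianceBilin_apply_eq_cov IsGaussian.memLp_two_id, covarianceBilin_stdGaussian,
    innerSL_apply_apply, inner_sub_right, ← Submodule.inner_starProjection_left_eq_right,
    Submodule.starProjection_eq_self_iff.2 x.2, sub_self]

/-- The conditional version of `mul_stdGaussian_cone_le` for the projection to a subspace, given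
an event that depends on the orthogonal component. -/
theorem mul_stdGaussian_face_le {L : Submodule ℝ E} (hL : L ≠ ⊥) {F N : Set E}
    (hF : MeasurableSet F) (hN : MeasurableSet N)
    (hcone : ∀ u ∈ F, ∀ t : ℝ, 0 < t → t • u ∈ F) {μ : E} (hμ : ∀ u ∈ F, u ∈ L → ⟪μ, u⟫ ≤ 0)
    {c : ℝ} {p : ℝ≥0∞} (hp : p ≤ stdGaussian L {u | ‖u‖ ^ 2 < c}) :
    p * stdGaussian E {z | L.starProjection (z + μ) ∈ F ∧ z - L.starProjection z ∈ N} ≤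
      stdGaussian E {z | (L.starProjection (z + μ) ∈ F ∧ ‖L.starProjection (z + μ)‖ ^ 2 < c) ∧
        z - L.starProjection z ∈ N} := by
  have : Nontrivial L := Submodule.nontrivial_iff_ne_bot.2 hL
  have hind := indepFun_orthogonalProjection_sub L
  set m : L := L.orthogonalProjectionOnto μ
  have hproj (z : E) : L.starProjection (z + μ) = ((L.orthogonalProjectionOnto z + m : L) : E) := by
    rw [map_add]; rfl
  -- By independence the factor of `N` is common to both sides, which leaves the cone inequality
  -- inside `L` with the projected mean `m`.
  have key (G : Set L) (hG : MeasurableSet G) :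
      stdGaussian E {z | L.orthogonalProjectionOnto z + m ∈ G ∧ z - L.starProjection z ∈ N} =
      stdGaussian L {v | v + m ∈ G} * stdGaussian E {z | z - L.starProjection z ∈ N} := by
    have hG' : MeasurableSet {v : L | v + m ∈ G} := measurable_add_const m hG
    have := hind.measure_inter_preimage_eq_mul _ _ hG' hN
    rw [← stdGaussian_map_orthogonalProjection L, Measure.map_apply (by fun_prop) hG']
    exact this
  have hF' : MeasurableSet {v : L | (v : E) ∈ F} := measurable_subtype_coe hF
  have h1 := key {v | (v : E) ∈ F} hF'
  have h2 := key {v | (v : E) ∈ F ∧ ‖v‖ ^ 2 < c}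
    (hF'.inter (measurableSet_lt (f := fun v : L => ‖v‖ ^ 2) (by fun_prop) measurable_const))
  simp only [Set.mem_ofPred_eq] at h1 h2
  simp only [hproj, Submodule.coe_norm] at h2 ⊢
  rw [h1, h2, ← mul_assoc]
  gcongr
  refine mul_stdGaussian_cone_le hF' (fun u hu t ht => by simpa using hcone _ hu t ht)
    (fun u hu => ?_) hp
  rw [Submodule.inner_orthogonalProjectionOnto_eq_of_mem_right]
  exact hμ _ hu u.2

theorem stdGaussian_norm_sq_eq_chiSq {k : ℕ} (hk : Module.finrank ℝ E = k) {s : Set ℝ}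
    (hs : MeasurableSet s) : stdGaussian E {u | ‖u‖ ^ 2 ∈ s} = chiSq k s := by
  subst hk
  have hmap := stdGaussian_map (stdOrthonormalBasis ℝ E).repr
  have hms : MeasurableSet {u : EuclideanSpace ℝ (Fin (Module.finrank ℝ E)) | ‖u‖ ^ 2 ∈ s} :=
    (by fun_prop : Measurable fun u : EuclideanSpace ℝ (Fin (Module.finrank ℝ E)) => ‖u‖ ^ 2) hs
  have h1 : stdGaussian E {u | ‖u‖ ^ 2 ∈ s} = stdGaussian (EuclideanSpace ℝ
      (Fin (Module.finrank ℝ E))) {u | ‖u‖ ^ 2 ∈ s} := by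
    rw [← hmap, Measure.map_apply (LinearIsometryEquiv.continuous _).measurable hms]
    simp
  rw [h1, ← map_pi_eq_stdGaussian, Measure.map_apply (by fun_prop) hms, chiSq,
    Measure.map_apply (by fun_prop) hs]
  congr 1
  ext z
  simp [EuclideanSpace.norm_sq_eq]

instance (k : ℕ) : IsProbabilityMeasure (stdNormal k) := by
  unfold stdNormal; infer_instance

instance (k : ℕ) : IsProbabilityMeasure (chiSq k) :=
  Measure.isProbabilityMeasure_map (Measurable.aemeasurable (by fun_prop))

/-- A level set of the squared norm lies in a sphere, which is null in positive dimension; for `k =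
0` there is an atom at zero. -/
theorem chiSq_singleton {k : ℕ} (hk : 1 ≤ k) (c : ℝ) : chiSq k {c} = 0 := by
  have : Nonempty (Fin k) := ⟨⟨0, hk⟩⟩
  rw [← stdGaussian_norm_sq_eq_chiSq (E := EuclideanSpace ℝ (Fin k)) (by simp)
    (measurableSet_singleton c)]
  refine stdGaussian_absolutelyContinuous _ ?_
  refine measure_mono_null (fun u hu => ?_) (Measure.addHaar_sphere volume 0 (Real.sqrt c))
  have hu' : ‖u‖ ^ 2 = c := hu
  simp [← hu']

/-- Right continuity of the distribution function gives the bound on the closed half-line, and the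
endpoint is not an atom. The open half-line is what the limit argument needs, since strict
inequalities persist under perturbation. -/
theorem le_chiSq_Iio_chiSqQuantile {k : ℕ} (hk : 1 ≤ k) {p : ℝ} (hp : p ∈ Set.Ioo (0 : ℝ) 1) :
    ENNReal.ofReal p ≤ chiSq k (Set.Iio (chiSqQuantile k p)) := by
  set S : Set ℝ := {x : ℝ | p ≤ cdf (chiSq k) x}
  have hne : S.Nonempty := by
    obtain ⟨x, hx⟩ := ((tendsto_cdf_atTop (chiSq k)).eventually (lt_mem_nhds hp.2)).exists
    exact ⟨x, le_of_lt hx⟩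
  have hq : p ≤ cdf (chiSq k) (chiSqQuantile k p) := by
    have hcont := ((cdf (chiSq k)).right_continuous (chiSqQuantile k p)).mono
      Set.Ioi_subset_Ici_self
    refine ge_of_tendsto hcont ?_
    filter_upwards [self_mem_nhdsWithin] with x hx
    obtain ⟨y, hy, hyx⟩ := exists_lt_of_csInf_lt hne (show sInf S < x from hx)
    exact le_trans hy (monotone_cdf _ hyx.le)
  calc ENNReal.ofReal p ≤ ENNReal.ofReal (cdf (chiSq k) (chiSqQuantile k p)) :=
        ENNReal.ofReal_le_ofReal hq
    _ = chiSq k (Set.Iic (chiSqQuantile k p)) := ofReal_cdf _ _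
    _ ≤ chiSq k (Set.Iio (chiSqQuantile k p)) + chiSq k {chiSqQuantile k p} := by
        rw [← Set.Iio_union_right]
        exact measure_union_le _ _
    _ = _ := by rw [chiSq_singleton hk, add_zero]

end Splitting

/-! ### Weak convergence from distribution functions. -/

section WeakConvergence

variable {m : ℕ}

/-- Convergence of distribution functions at every point implies weak convergence. -/
theorem tendsto_probabilityMeasure_of_tendsto_Iic {ι : Type*} {l : Filter ι}
    [l.IsCountablyGenerated] {μ : ι → ProbabilityMeasure (Fin m → ℝ)}
    {ν : ProbabilityMeasure (Fin m → ℝ)}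
    (h : ∀ t, Tendsto (fun i => (μ i : Measure (Fin m → ℝ)) (Set.Iic t)) l
      (𝓝 ((ν : Measure (Fin m → ℝ)) (Set.Iic t)))) :
    Tendsto μ l (𝓝 ν) := by
  have hreal (t : Fin m → ℝ) : Tendsto (fun i => (μ i : Measure (Fin m → ℝ)).real (Set.Iic t)) l
      (𝓝 ((ν : Measure (Fin m → ℝ)).real (Set.Iic t))) :=
    (ENNReal.tendsto_toReal (measure_ne_top _ _)).comp (h t)
  -- A half-open box is an orthant minus a finite union of orthants. The measure of such a union
  -- converges by inclusion–exclusion, since orthants form a π-system.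
  have hbox (a b : Fin m → ℝ) : (Set.univ.pi fun i => Set.Ioc (a i) (b i)) =
      Set.Iic b \ ⋃ s ∈ Finset.univ.image fun i => Set.Iic (Function.update b i (a i)), s := by
    ext x
    simp only [Set.mem_pi, Set.mem_univ, true_imp_iff, Set.mem_Ioc, Set.mem_sdiff, Set.mem_Iic,
      Finset.mem_image, Finset.mem_univ, true_and, Set.iUnion_exists, Set.iUnion_iUnion_eq',
      Set.mem_iUnion, not_exists]
    constructor
    · exact fun hx => ⟨fun i => (hx i).2, fun i hi => absurd (hi i) (by simpa using (hx i).1)⟩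
    · refine fun hx i => ⟨not_le.1 fun hi => hx.2 i fun j => ?_, hx.1 i⟩
      by_cases hj : j = i
      · subst hj; simpa using hi
      · simpa [hj] using hx.1 j
  have hIic : IsPiSystem (Set.range (Set.Iic : (Fin m → ℝ) → Set (Fin m → ℝ))) := by
    rintro _ ⟨a, rfl⟩ _ ⟨b, rfl⟩ -
    exact ⟨a ⊓ b, Set.Iic_inter_Iic.symm⟩
  have hsub (a b : Fin m → ℝ) (hab : a ≤ b) :
      (⋃ s ∈ Finset.univ.image fun i => Set.Iic (Function.update b i (a i)), s) ⊆ Set.Iic b := by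
    intro x
    simp only [Finset.mem_image, Finset.mem_univ, true_and, Set.iUnion_exists,
      Set.iUnion_iUnion_eq', Set.mem_iUnion, Set.mem_Iic, forall_exists_index]
    exact fun i hi => hi.trans (by
      rw [update_le_iff]; exact ⟨hab i, fun _ _ => le_rfl⟩)
  refine IsPiSystem.tendsto_probabilityMeasure_of_tendsto_of_mem
    (S := {s | ∃ a b : Fin m → ℝ, a ≤ b ∧ s = Set.univ.pi fun i => Set.Ioc (a i) (b i)}) ?_ ?_ ?_ ?_
  · rintro _ ⟨a, b, hab, rfl⟩ _ ⟨a', b', hab', rfl⟩ hne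
    refine ⟨a ⊔ a', b ⊓ b', fun i => ?_, ?_⟩
    · obtain ⟨x, hx, hx'⟩ := hne
      have h1 := hx i trivial
      have h2 := hx' i trivial
      simp only [Set.mem_Ioc] at h1 h2
      simp only [Pi.sup_apply, Pi.inf_apply, sup_le_iff, le_inf_iff]
      exact ⟨⟨h1.1.le.trans h1.2, h2.1.le.trans h1.2⟩, ⟨h1.1.le.trans h2.2, h2.1.le.trans h2.2⟩⟩
    · rw [← Set.pi_inter_distrib]
      simp only [Set.Ioc_inter_Ioc, Pi.sup_apply, Pi.inf_apply]
  · rintro _ ⟨a, b, -, rfl⟩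
    exact MeasurableSet.univ_pi fun i => measurableSet_Ioc
  · intro u hu x hx
    obtain ⟨ε, hε, hball⟩ := Metric.isOpen_iff.1 hu x hx
    refine ⟨_, ⟨fun i => x i - ε / 2, fun i => x i + ε / 2, fun i => ?_, rfl⟩, ?_, ?_⟩
    · change x i - ε / 2 ≤ x i + ε / 2
      linarith
    · exact set_pi_mem_nhds Set.finite_univ fun i _ => Ioc_mem_nhds (by linarith) (by linarith)
    · refine fun y hy => hball ?_
      refine (dist_pi_lt_iff hε).2 fun i => ?_
      have := hy i trivial
      rw [Real.dist_eq, abs_lt]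
      constructor <;> linarith [this.1, this.2]
  · rintro _ ⟨a, b, hab, rfl⟩
    rw [hbox a b]
    have hm : MeasurableSet (⋃ s ∈ Finset.univ.image fun i =>
        Set.Iic (Function.update b i (a i)), s) := by
      refine Finset.measurableSet_biUnion _ fun s hs => ?_
      obtain ⟨i, -, rfl⟩ := Finset.mem_image.1 hs
      exact measurableSet_Iic
    have hU := hIic.tendsto_measureReal_biUnion
      (μ := fun i => (μ i : Measure (Fin m → ℝ))) (ν := (ν : Measure (Fin m → ℝ))) (l := l)
      (t := Finset.univ.image fun i => Set.Iic (Function.update b i (a i)))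
      (fun s hs => by
        obtain ⟨i, -, rfl⟩ := Finset.mem_image.1 hs
        exact ⟨_, rfl⟩)
      (by rintro _ ⟨t, rfl⟩; exact measurableSet_Iic)
      (by rintro _ ⟨t, rfl⟩; exact hreal t)
    have hd := (hreal b).sub hU
    rw [← NNReal.tendsto_coe]
    simp only [← ProbabilityMeasure.measureReal_eq_coe_coeFn]
    have hsd (ρ : ProbabilityMeasure (Fin m → ℝ)) :=
      measureReal_sdiff (μ := (ρ : Measure (Fin m → ℝ))) (hsub a b hab) hm
    simp_rw [hsd]
    exact hd

end WeakConvergence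

/-! ### Regression on a fixed set of rows. -/

section ActiveSet

variable {K m : ℕ} (B : Matrix (Fin K) (Fin m) ℝ)

/-- The rows of `B` with index in `A` are linearly independent. -/
def RowsIndependent (A : Finset (Fin K)) : Prop :=
  ∀ l : Fin K → ℝ, (∀ j ∉ A, l j = 0) → Bᵀ *ᵥ l = 0 → l = 0

/-- The matrix of the normal equations for the multipliers supported in `A`. -/
noncomputable def activeMatrix (A : Finset (Fin K)) (S : Matrix (Fin m) (Fin m) ℝ) :
    Matrix (Fin K) (Fin K) ℝ :=
  -- Identity rows outside `A` force the multipliers there to vanish while the system stays square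
  -- of size `K`.
  Matrix.of fun i j => if i ∈ A then (B * S⁻¹ * Bᵀ) i j else (1 : Matrix (Fin K) (Fin K) ℝ) i j

/-- The minimiser of `‖x - B' l‖²_S` over all `l` supported in `A`. -/
noncomputable def activeMultiplier (A : Finset (Fin K)) (S : Matrix (Fin m) (Fin m) ℝ)
    (x : Fin m → ℝ) : Fin K → ℝ :=
  (activeMatrix B A S)⁻¹ *ᵥ fun i => if i ∈ A then (B *ᵥ (S⁻¹ *ᵥ x)) i else 0

/-- The residual of the regression of `x` on the rows of `B` in `A`. -/
noncomputable def activeResidual (A : Finset (Fin K)) (S : Matrix (Fin m) (Fin m) ℝ)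
    (x : Fin m → ℝ) : Fin m → ℝ :=
  x - Bᵀ *ᵥ activeMultiplier B A S x

variable {B} {A : Finset (Fin K)} {S : Matrix (Fin m) (Fin m) ℝ}

theorem RowsIndependent.mono {A' : Finset (Fin K)} (h : RowsIndependent B A') (hA : A ⊆ A') :
    RowsIndependent B A :=
  fun l hl => h l fun j hj => hl j fun h => hj (hA h)

theorem PosDef.sqNorm_pos (hS : S.PosDef) {x : Fin m → ℝ} (hx : x ≠ 0) : 0 < sqNorm S x := by
  simpa [sqNorm] using hS.inv.dotProduct_mulVec_pos hx

theorem PosDef.sqNorm_nonneg (hS : S.PosDef) (x : Fin m → ℝ) : 0 ≤ sqNorm S x := by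
  simpa [sqNorm] using hS.inv.posSemidef.dotProduct_mulVec_nonneg x

theorem sqNorm_smul (S : Matrix (Fin m) (Fin m) ℝ) (a : ℝ) (x : Fin m → ℝ) :
    sqNorm S (a • x) = a ^ 2 * sqNorm S x := by
  simp [sqNorm, Matrix.mulVec_smul]
  ring

theorem activeMatrix_mulVec (S : Matrix (Fin m) (Fin m) ℝ) (l : Fin K → ℝ) (i : Fin K) :
    (activeMatrix B A S *ᵥ l) i =
      if i ∈ A then (B *ᵥ (S⁻¹ *ᵥ (Bᵀ *ᵥ l))) i else l i := by
  by_cases hi : i ∈ A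
  · simp only [hi, if_true, Matrix.mulVec_mulVec, ← Matrix.mul_assoc]
    simp [activeMatrix, Matrix.mulVec, dotProduct, hi]
  · simp only [hi, if_false]
    conv_rhs => rw [← Matrix.one_mulVec l]
    simp [activeMatrix, Matrix.mulVec, dotProduct, hi]

/-- A kernel vector `l` is supported in `A`, and its slacks vanish on `A`, so `‖B' l‖²_S = l · B S⁻¹
B' l = 0`; independence of the rows then gives `l = 0`. -/
theorem isUnit_activeMatrix (hA : RowsIndependent B A) (hS : S.PosDef) :
    IsUnit (activeMatrix B A S) := by
  rw [← Matrix.mulVec_injective_iff_isUnit]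
  refine (injective_iff_map_eq_zero (activeMatrix B A S).mulVecLin).2 fun l hl => ?_
  have hl' (i : Fin K) := (activeMatrix_mulVec (B := B) (A := A) S l i).symm.trans (congrFun hl i)
  have hsupp : ∀ j ∉ A, l j = 0 := fun j hj => by simpa [hj] using hl' j
  refine hA l hsupp ?_
  by_contra hne
  have h1 := PosDef.sqNorm_pos hS hne
  have h2 : sqNorm S (Bᵀ *ᵥ l) = l ⬝ᵥ (B *ᵥ (S⁻¹ *ᵥ (Bᵀ *ᵥ l))) := by
    rw [sqNorm, Matrix.dotProduct_mulVec l, Matrix.mulVec_transpose]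
  rw [h2] at h1
  refine h1.ne' (Finset.sum_eq_zero fun j _ => ?_)
  by_cases hj : j ∈ A
  · have := hl' j
    simp only [hj, if_true, Pi.zero_apply] at this
    rw [this, mul_zero]
  · rw [hsupp j hj, zero_mul]

theorem activeMatrix_mulVec_activeMultiplier (hA : RowsIndependent B A) (hS : S.PosDef)
    (x : Fin m → ℝ) (i : Fin K) : (activeMatrix B A S *ᵥ activeMultiplier B A S x) i =
      if i ∈ A then (B *ᵥ (S⁻¹ *ᵥ x)) i else 0 := by
  rw [activeMultiplier, Matrix.mulVec_mulVec, Matrix.mul_nonsing_inv _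
    ((Matrix.isUnit_iff_isUnit_det _).1 (isUnit_activeMatrix hA hS)), Matrix.one_mulVec]

theorem activeMultiplier_of_notMem (hA : RowsIndependent B A) (hS : S.PosDef)
    (x : Fin m → ℝ) {i : Fin K} (hi : i ∉ A) : activeMultiplier B A S x i = 0 := by
  have := activeMatrix_mulVec_activeMultiplier hA hS x i
  rw [activeMatrix_mulVec] at this
  simpa [hi] using this

theorem mulVec_activeResidual_of_mem (hA : RowsIndependent B A) (hS : S.PosDef)
    (x : Fin m → ℝ) {i : Fin K} (hi : i ∈ A) :
    (B *ᵥ (S⁻¹ *ᵥ activeResidual B A S x)) i = 0 := by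
  have := activeMatrix_mulVec_activeMultiplier hA hS x i
  rw [activeMatrix_mulVec] at this
  simp only [hi, if_true] at this
  rw [activeResidual, Matrix.mulVec_sub, Matrix.mulVec_sub, Pi.sub_apply, this, sub_self]

/-- Support and normal equations determine the multiplier, by injectivity of `activeMatrix`; this
identifies multipliers obtained by other means. -/
theorem activeMultiplier_eq (hA : RowsIndependent B A) (hS : S.PosDef) {x : Fin m → ℝ}
    {l : Fin K → ℝ} (hl : ∀ j ∉ A, l j = 0)
    (h : ∀ j ∈ A, (B *ᵥ (S⁻¹ *ᵥ (x - Bᵀ *ᵥ l))) j = 0) : activeMultiplier B A S x = l := by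
  have hinj := Matrix.mulVec_injective_of_isUnit (isUnit_activeMatrix hA hS)
  refine hinj (funext fun i => ?_)
  simp only [activeMatrix_mulVec_activeMultiplier hA hS, activeMatrix_mulVec]
  by_cases hi : i ∈ A
  · have := h i hi
    rw [Matrix.mulVec_sub, Matrix.mulVec_sub, Pi.sub_apply, sub_eq_zero] at this
    simp only [hi, if_true, this]
  · simp [hi, hl i hi]

theorem continuousAt_matrix_inv {n : Type*} [Fintype n] [DecidableEq n] {M : Matrix n n ℝ}
    (hM : IsUnit M) : ContinuousAt (fun N : Matrix n n ℝ => N⁻¹) M := by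
  have hdet : M.det ≠ 0 := ((Matrix.isUnit_iff_isUnit_det M).1 hM).ne_zero
  simp only [Matrix.inv_def, Ring.inverse_eq_inv']
  exact ((Continuous.matrix_det continuous_id).continuousAt.inv₀ hdet).smul
    (Continuous.matrix_adjugate continuous_id).continuousAt

/-- Continuity holds jointly in variance and data, because inversion is continuous at invertible
matrices. It makes strict inequalities at the limit persist for estimated variances. -/
theorem continuousAt_activeMultiplier (hA : RowsIndependent B A) (hS : S.PosDef)
    (x : Fin m → ℝ) :
    ContinuousAt (fun p : Matrix (Fin m) (Fin m) ℝ × (Fin m → ℝ) =>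
      activeMultiplier B A p.1 p.2) (S, x) := by
  have hinv : ContinuousAt (fun p : Matrix (Fin m) (Fin m) ℝ × (Fin m → ℝ) => p.1⁻¹) (S, x) :=
    ContinuousAt.comp (f := Prod.fst) (continuousAt_matrix_inv hS.isUnit) continuousAt_fst
  have hM : ContinuousAt (fun p : Matrix (Fin m) (Fin m) ℝ × (Fin m → ℝ) =>
      activeMatrix B A p.1) (S, x) := by
    refine continuousAt_pi.2 fun i => continuousAt_pi.2 fun j => ?_
    by_cases hi : i ∈ A
    · simp only [activeMatrix, Matrix.of_apply, hi, if_true]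
      have h := (continuous_const (y := B)).matrix_mul
        (continuous_id (X := Matrix (Fin m) (Fin m) ℝ)) |>.matrix_mul
        (continuous_const (y := Bᵀ)) |>.matrix_elem i j
      exact h.continuousAt.comp hinv
    · simp only [activeMatrix, Matrix.of_apply, hi, if_false]
      exact continuousAt_const
  have hMinv : ContinuousAt (fun p : Matrix (Fin m) (Fin m) ℝ × (Fin m → ℝ) =>
      (activeMatrix B A p.1)⁻¹) (S, x) :=
    ContinuousAt.comp (f := fun p : Matrix (Fin m) (Fin m) ℝ × (Fin m → ℝ) =>
      activeMatrix B A p.1) (continuousAt_matrix_inv (isUnit_activeMatrix hA hS)) hM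
  have hmv {a b : ℕ} : Continuous fun q : Matrix (Fin a) (Fin b) ℝ × (Fin b → ℝ) =>
      q.1 *ᵥ q.2 := continuous_fst.matrix_mulVec continuous_snd
  have hv : ContinuousAt (fun p : Matrix (Fin m) (Fin m) ℝ × (Fin m → ℝ) =>
      fun i => if i ∈ A then (B *ᵥ (p.1⁻¹ *ᵥ p.2)) i else 0) (S, x) := by
    refine continuousAt_pi.2 fun i => ?_
    by_cases hi : i ∈ A
    · simp only [hi, if_true]
      have h1 := ContinuousAt.comp (f := fun p : Matrix (Fin m) (Fin m) ℝ × (Fin m → ℝ) =>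
        (p.1⁻¹, p.2)) hmv.continuousAt (hinv.prodMk continuousAt_snd)
      exact (continuous_apply i).continuousAt.comp
        (((continuous_const (y := B)).matrix_mulVec continuous_id).continuousAt.comp h1)
    · simp only [hi, if_false]
      exact continuousAt_const
  exact ContinuousAt.comp (f := fun p : Matrix (Fin m) (Fin m) ℝ × (Fin m → ℝ) =>
    ((activeMatrix B A p.1)⁻¹, fun i => if i ∈ A then (B *ᵥ (p.1⁻¹ *ᵥ p.2)) i else 0))
    hmv.continuousAt (hMinv.prodMk hv)

theorem continuousAt_activeResidual (hA : RowsIndependent B A) (hS : S.PosDef)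
    (x : Fin m → ℝ) :
    ContinuousAt (fun p : Matrix (Fin m) (Fin m) ℝ × (Fin m → ℝ) =>
      activeResidual B A p.1 p.2) (S, x) :=
  continuousAt_snd.sub (((continuous_const (y := Bᵀ)).matrix_mulVec
    continuous_id).continuousAt.comp (continuousAt_activeMultiplier hA hS x))

theorem continuousAt_inv_mulVec_activeResidual (hA : RowsIndependent B A) (hS : S.PosDef)
    (x : Fin m → ℝ) :
    ContinuousAt (fun p : Matrix (Fin m) (Fin m) ℝ × (Fin m → ℝ) =>
      p.1⁻¹ *ᵥ activeResidual B A p.1 p.2) (S, x) := by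
  have hinv : ContinuousAt (fun p : Matrix (Fin m) (Fin m) ℝ × (Fin m → ℝ) => p.1⁻¹) (S, x) :=
    ContinuousAt.comp (f := Prod.fst) (continuousAt_matrix_inv hS.isUnit) continuousAt_fst
  have hmv : Continuous fun q : Matrix (Fin m) (Fin m) ℝ × (Fin m → ℝ) =>
      q.1 *ᵥ q.2 := continuous_fst.matrix_mulVec continuous_snd
  exact ContinuousAt.comp (f := fun p : Matrix (Fin m) (Fin m) ℝ × (Fin m → ℝ) =>
    (p.1⁻¹, activeResidual B A p.1 p.2)) hmv.continuousAt
    (hinv.prodMk (continuousAt_activeResidual hA hS x))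

theorem continuousAt_slack (hA : RowsIndependent B A) (hS : S.PosDef)
    (x : Fin m → ℝ) (j : Fin K) :
    ContinuousAt (fun p : Matrix (Fin m) (Fin m) ℝ × (Fin m → ℝ) =>
      (B *ᵥ (p.1⁻¹ *ᵥ activeResidual B A p.1 p.2)) j) (S, x) :=
  (continuous_apply j).continuousAt.comp (((continuous_const (y := B)).matrix_mulVec
    continuous_id).continuousAt.comp (continuousAt_inv_mulVec_activeResidual hA hS x))

theorem continuousAt_sqNorm_activeResidual (hA : RowsIndependent B A) (hS : S.PosDef)
    (x : Fin m → ℝ) :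
    ContinuousAt (fun p : Matrix (Fin m) (Fin m) ℝ × (Fin m → ℝ) =>
      sqNorm p.1 (activeResidual B A p.1 p.2)) (S, x) := by
  have hdp : Continuous fun q : (Fin m → ℝ) × (Fin m → ℝ) => q.1 ⬝ᵥ q.2 :=
    continuous_fst.dotProduct continuous_snd
  exact ContinuousAt.comp (f := fun p : Matrix (Fin m) (Fin m) ℝ × (Fin m → ℝ) =>
    (activeResidual B A p.1 p.2, p.1⁻¹ *ᵥ activeResidual B A p.1 p.2)) hdp.continuousAt
    ((continuousAt_activeResidual hA hS x).prodMk (continuousAt_inv_mulVec_activeResidual hA hS x))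

end ActiveSet

/-! ### Optimality conditions for the projection to the cone. -/

section KKT

variable {K m : ℕ}

/-- The optimality conditions for minimising `‖y - B' l‖²_S` over all `l` that vanish outside
`J` and are nonnegative outside `I`. -/
structure IsKKT (B : Matrix (Fin K) (Fin m) ℝ) (S : Matrix (Fin m) (Fin m) ℝ)
    (J I : Finset (Fin K)) (y : Fin m → ℝ) (l : Fin K → ℝ) : Prop where
  supp : ∀ j ∉ J, l j = 0
  nonneg : ∀ j ∉ I, 0 ≤ l j
  -- The slack is minus half the gradient of the objective in `l`.
  slack_nonpos : ∀ j ∈ J, (B *ᵥ (S⁻¹ *ᵥ (y - Bᵀ *ᵥ l))) j ≤ 0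
  slack_eq_zero : ∀ j ∈ I, (B *ᵥ (S⁻¹ *ᵥ (y - Bᵀ *ᵥ l))) j = 0
  complementary : ∀ j, l j * (B *ᵥ (S⁻¹ *ᵥ (y - Bᵀ *ᵥ l))) j = 0

variable {B : Matrix (Fin K) (Fin m) ℝ} {S : Matrix (Fin m) (Fin m) ℝ} {J I : Finset (Fin K)}
  {y : Fin m → ℝ} {l l' : Fin K → ℝ}

theorem dotProduct_inv_mulVec_comm (hS : S.PosDef) (a b : Fin m → ℝ) :
    a ⬝ᵥ (S⁻¹ *ᵥ b) = b ⬝ᵥ (S⁻¹ *ᵥ a) := by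
  have h : (S⁻¹)ᵀ = S⁻¹ := by simpa using hS.inv.isHermitian.eq
  rw [Matrix.dotProduct_mulVec, ← Matrix.mulVec_transpose, h, dotProduct_comm]

theorem transpose_mulVec_dotProduct (B : Matrix (Fin K) (Fin m) ℝ) (l : Fin K → ℝ)
    (g : Fin m → ℝ) : (Bᵀ *ᵥ l) ⬝ᵥ g = l ⬝ᵥ (B *ᵥ g) := by
  rw [Matrix.mulVec_transpose, Matrix.dotProduct_mulVec]

/-- With slacks `s`, `s'`, the squared distance of the residuals is `∑ (l' - l) (s - s')`.
Complementarity reduces it to `∑ (l' s + l s')`, in which every term is nonpositive. -/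
theorem IsKKT.residual_unique (hS : S.PosDef) (h : IsKKT B S J I y l) (h' : IsKKT B S J I y l') :
    y - Bᵀ *ᵥ l = y - Bᵀ *ᵥ l' := by
  set r := y - Bᵀ *ᵥ l
  set r' := y - Bᵀ *ᵥ l'
  by_contra hne
  have hpos := PosDef.sqNorm_pos hS (sub_ne_zero.2 hne)
  have hrr : r - r' = Bᵀ *ᵥ (l' - l) := by
    simp only [r, r', Matrix.mulVec_sub]; abel
  have heq : sqNorm S (r - r') = ∑ j, (l' - l) j *
      ((B *ᵥ (S⁻¹ *ᵥ r)) j - (B *ᵥ (S⁻¹ *ᵥ r')) j) := by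
    rw [sqNorm]
    nth_rewrite 1 [hrr]
    rw [transpose_mulVec_dotProduct, Matrix.mulVec_sub, Matrix.mulVec_sub]
    rfl
  rw [heq] at hpos
  refine absurd hpos (not_lt.2 (Finset.sum_nonpos fun j _ => ?_))
  have e1 := h.complementary j
  have e2 := h'.complementary j
  have : (l' - l) j * ((B *ᵥ (S⁻¹ *ᵥ r)) j - (B *ᵥ (S⁻¹ *ᵥ r')) j) =
      l' j * (B *ᵥ (S⁻¹ *ᵥ r)) j + l j * (B *ᵥ (S⁻¹ *ᵥ r')) j := by
    rw [Pi.sub_apply]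
    linear_combination -e1 - e2
  rw [this]
  by_cases hI : j ∈ I
  · rw [h.slack_eq_zero j hI, h'.slack_eq_zero j hI]; simp
  by_cases hJ : j ∈ J
  · exact add_nonpos (mul_nonpos_of_nonneg_of_nonpos (h'.nonneg j hI) (h.slack_nonpos j hJ))
      (mul_nonpos_of_nonneg_of_nonpos (h.nonneg j hI) (h'.slack_nonpos j hJ))
  · rw [h.supp j hJ, h'.supp j hJ]; simp

/-- Sufficiency of the conditions, by convexity: in the expansion around `l` the linear term is
nonnegative for every feasible `l'`. -/
theorem IsKKT.sqNorm_le (hS : S.PosDef) (h : IsKKT B S J ∅ y l) (hsupp : ∀ j ∉ J, l' j = 0)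
    (hnn : ∀ j, 0 ≤ l' j) : sqNorm S (y - Bᵀ *ᵥ l) ≤ sqNorm S (y - Bᵀ *ᵥ l') := by
  set r := y - Bᵀ *ᵥ l with hr
  have hrr : y - Bᵀ *ᵥ l' = r - Bᵀ *ᵥ (l' - l) := by
    simp only [hr, Matrix.mulVec_sub]; abel
  have hexp : sqNorm S (r - Bᵀ *ᵥ (l' - l)) = sqNorm S r + sqNorm S (Bᵀ *ᵥ (l' - l)) -
      2 * ∑ j, (l' - l) j * (B *ᵥ (S⁻¹ *ᵥ r)) j := by
    have : ∑ j, (l' - l) j * (B *ᵥ (S⁻¹ *ᵥ r)) j = (Bᵀ *ᵥ (l' - l)) ⬝ᵥ (S⁻¹ *ᵥ r) := by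
      rw [transpose_mulVec_dotProduct]; rfl
    rw [this]
    generalize Bᵀ *ᵥ (l' - l) = b
    rw [sqNorm, sqNorm, sqNorm, Matrix.mulVec_sub, sub_dotProduct, dotProduct_sub,
      dotProduct_sub, dotProduct_inv_mulVec_comm hS r b]
    ring
  have hle : ∑ j, (l' - l) j * (B *ᵥ (S⁻¹ *ᵥ r)) j ≤ 0 := by
    refine Finset.sum_nonpos fun j _ => ?_
    rw [Pi.sub_apply, sub_mul, h.complementary j, sub_zero]
    by_cases hJ : j ∈ J
    · exact mul_nonpos_of_nonneg_of_nonpos (hnn j) (h.slack_nonpos j hJ)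
    · rw [hsupp j hJ, zero_mul]
  rw [hrr, hexp]
  linarith [PosDef.sqNorm_nonneg hS (Bᵀ *ᵥ (l' - l))]

/-- The optimality conditions have a solution. -/
theorem exists_isKKT {H : Matrix (Fin m) (Fin m) ℝ} (hHsymm : Hᵀ = H) (hHS : S = H * H)
    (hS : S.PosDef) (hJ : RowsIndependent B J) (hIJ : I ⊆ J) (y : Fin m → ℝ) :
    ∃ l, IsKKT B S J I y l := by
  have hHu : IsUnit H.det := by
    have : IsUnit S.det := (Matrix.isUnit_iff_isUnit_det S).1 hS.isUnit
    rw [hHS, Matrix.det_mul] at this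
    exact isUnit_of_mul_isUnit_left this
  let W : Submodule ℝ (Fin K → ℝ) :=
    { carrier := {l | ∀ j ∉ J, l j = 0}
      add_mem' := fun {a b} ha hb j hj => by simp [ha j hj, hb j hj]
      zero_mem' := fun j _ => rfl
      smul_mem' := fun c a ha j hj => by simp [ha j hj] }
  -- Whitening by `H⁻¹` makes this a Euclidean projection to a convex set. Independent rows make the
  -- map injective on `W`, hence the image of `D` closed.
  let Φ : (Fin K → ℝ) →ₗ[ℝ] EuclideanSpace ℝ (Fin m) :=
    (WithLp.linearEquiv 2 ℝ (Fin m → ℝ)).symm.toLinearMap ∘ₗ (H⁻¹ * Bᵀ).mulVecLin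
  have hΦ (l : Fin K → ℝ) : Φ l = WithLp.toLp 2 (H⁻¹ *ᵥ (Bᵀ *ᵥ l)) := by
    rw [Matrix.mulVec_mulVec]; rfl
  let Ψ : W →ₗ[ℝ] EuclideanSpace ℝ (Fin m) := Φ.domRestrict W
  have hker : LinearMap.ker Ψ = ⊥ := by
    refine LinearMap.ker_eq_bot'.2 fun l hl => ?_
    have h1 : H⁻¹ *ᵥ (Bᵀ *ᵥ l.1) = 0 := by
      have : Φ l.1 = 0 := hl
      rw [hΦ] at this
      simpa using this
    have h2 : Bᵀ *ᵥ l.1 = 0 := by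
      have := congrArg (H *ᵥ ·) h1
      simpa [Matrix.mulVec_mulVec, ← Matrix.mul_assoc, Matrix.mul_nonsing_inv _ hHu] using this
    exact Subtype.ext (hJ l.1 l.2 h2)
  let D : Set W := {l | ∀ j ∉ I, 0 ≤ l.1 j}
  have hDclosed : IsClosed D := by
    simp only [D, Set.ofPred_forall]
    refine isClosed_iInter fun j => isClosed_iInter fun _ => ?_
    exact isClosed_le continuous_const ((continuous_apply j).comp continuous_subtype_val)
  have hDconv : Convex ℝ D := fun a ha b hb s t hs ht _ j hj => by
    have := ha j hj
    have := hb j hj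
    simp only [Submodule.coe_add, Submodule.coe_smul, Pi.add_apply, Pi.smul_apply, smul_eq_mul]
    positivity
  have hcl : IsClosed (Ψ '' D) :=
    (LinearMap.isClosedEmbedding_of_injective hker).isClosedMap _ hDclosed
  have hne : (Ψ '' D).Nonempty := ⟨Ψ 0, 0, fun j _ => le_rfl, rfl⟩
  obtain ⟨_, ⟨l, hl, rfl⟩, hmin⟩ := exists_norm_eq_iInf_of_complete_convex hne hcl.isComplete
    (hDconv.linear_image Ψ) (WithLp.toLp 2 (H⁻¹ *ᵥ y))
  rw [norm_eq_iInf_iff_real_inner_le_zero (hDconv.linear_image Ψ) ⟨l, hl, rfl⟩] at hmin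
  set s : Fin K → ℝ := B *ᵥ (S⁻¹ *ᵥ (y - Bᵀ *ᵥ l.1)) with hs
  have hvar (l' : W) (hl' : l' ∈ D) : ∑ j, (l'.1 j - l.1 j) * s j ≤ 0 := by
    have := hmin _ ⟨l', hl', rfl⟩
    have e1 : (WithLp.toLp 2 (H⁻¹ *ᵥ y) : EuclideanSpace ℝ (Fin m)) - Ψ l =
        WithLp.toLp 2 (H⁻¹ *ᵥ (y - Bᵀ *ᵥ l.1)) := by
      change _ - Φ l.1 = _
      rw [hΦ, Matrix.mulVec_sub]; rfl
    have e2 : Ψ l' - Ψ l = WithLp.toLp 2 (H⁻¹ *ᵥ (Bᵀ *ᵥ (l'.1 - l.1))) := by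
      rw [← hΦ, map_sub]; rfl
    rw [e1, e2, EuclideanSpace.inner_toLp_toLp] at this
    have hHinv : (H⁻¹)ᵀ = H⁻¹ := by rw [Matrix.transpose_nonsing_inv, hHsymm]
    have e3 : (H⁻¹ *ᵥ (Bᵀ *ᵥ (l'.1 - l.1))) ⬝ᵥ (H⁻¹ *ᵥ (y - Bᵀ *ᵥ l.1)) =
        ∑ j, (l'.1 j - l.1 j) * s j := by
      rw [Matrix.dotProduct_mulVec, ← Matrix.mulVec_transpose, hHinv, Matrix.mulVec_mulVec,
        ← Matrix.mul_inv_rev, ← hHS, dotProduct_comm, dotProduct_inv_mulVec_comm hS,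
        transpose_mulVec_dotProduct]
      rfl
    rw [← e3]
    exact this
  -- Only coordinate `j` is varied. The choice `t = 1` bounds the slack, `t = ±1` makes it zero for
  -- a free coordinate, and `t = ±l j` gives complementarity.
  have hstep (j : Fin K) (hj : j ∈ J) (t : ℝ) (ht : j ∉ I → 0 ≤ l.1 j + t) : t * s j ≤ 0 := by
    have hmem : Function.update l.1 j (l.1 j + t) ∈ W := fun i hi => by
      have hij : i ≠ j := fun h => hi (h ▸ hj)
      simpa [hij] using l.2 i hi
    have := hvar ⟨_, hmem⟩ fun i hi => by
      by_cases hij : i = j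
      · subst hij; simpa using ht hi
      · simpa [hij] using hl i hi
    rw [Finset.sum_eq_single j] at this
    · simpa using this
    · intro i _ hij; simp [hij]
    · simp
  refine ⟨l.1, l.2, hl, fun j hj => ?_, fun j hj => ?_, fun j => ?_⟩
  · have := hstep j hj 1 fun hI => by linarith [hl j hI]
    linarith
  · have h1 := hstep j (hIJ hj) 1 fun hI => absurd hj hI
    have h2 := hstep j (hIJ hj) (-1) fun hI => absurd hj hI
    linarith
  · by_cases hj : j ∈ J
    · by_cases hI : j ∈ I
      · have h1 := hstep j hj 1 fun h => absurd hI h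
        have h2 := hstep j hj (-1) fun h => absurd hI h
        rw [← hs, show s j = 0 by linarith, mul_zero]
      · have h1 := hstep j hj (l.1 j) fun _ => by linarith [hl j hI]
        have h2 := hstep j hj (-l.1 j) fun _ => by linarith
        linarith
    · rw [l.2 j hj, zero_mul]

end KKT

/-! ### Active sets with strict complementarity. -/

section Region

variable {K m : ℕ}

/-- `A` is the set of active constraints, with strict complementarity: the multipliers in `A` that
are required to be nonnegative are positive, and the slack vector has no zeros outside `A`. -/
structure InRegion (B : Matrix (Fin K) (Fin m) ℝ) (S : Matrix (Fin m) (Fin m) ℝ)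
    (J I A : Finset (Fin K)) (ν : Fin K → ℝ) (x : Fin m → ℝ) : Prop where
  multiplier_pos : ∀ j ∈ A, j ∉ I → 0 < activeMultiplier B A S x j + ν j
  slack_neg : ∀ j ∈ J, j ∉ A → (B *ᵥ (S⁻¹ *ᵥ activeResidual B A S x)) j < 0
  -- With `m` independent active rows the residual is zero and every slack vanishes, whence the
  -- exception.
  slack_ne : A.card ≠ m → ∀ j ∉ J, (B *ᵥ (S⁻¹ *ᵥ activeResidual B A S x)) j ≠ 0

variable {B : Matrix (Fin K) (Fin m) ℝ} {S : Matrix (Fin m) (Fin m) ℝ} {J I A : Finset (Fin K)}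
  {ν : Fin K → ℝ} {x₀ : Fin m → ℝ}

/-- The data with the part of the mean that is explained by the active constraints removed. -/
noncomputable def reduced (B : Matrix (Fin K) (Fin m) ℝ) (A : Finset (Fin K)) (ν : Fin K → ℝ)
    (x₀ : Fin m → ℝ) : Fin m → ℝ :=
  x₀ + Bᵀ *ᵥ (A : Set (Fin K))ᶜ.indicator ν

theorem mulVec_eq_reduced_add (B : Matrix (Fin K) (Fin m) ℝ) (A : Finset (Fin K)) (ν : Fin K → ℝ)
    (x₀ : Fin m → ℝ) :
    x₀ + Bᵀ *ᵥ ν = reduced B A ν x₀ + Bᵀ *ᵥ (A : Set (Fin K)).indicator ν := by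
  have h := Set.indicator_self_add_compl (A : Set (Fin K)) ν
  rw [reduced, add_assoc, ← Matrix.mulVec_add, add_comm (Set.indicator _ ν), h]

/-- A mean in the span of the active rows is absorbed by the multiplier. The residual therefore
involves `ν` only outside `A`, which matters when components of `ν` inside `A` diverge. -/
theorem sub_eq_activeResidual (B : Matrix (Fin K) (Fin m) ℝ) (S : Matrix (Fin m) (Fin m) ℝ)
    (A : Finset (Fin K)) (ν : Fin K → ℝ) (x₀ : Fin m → ℝ) :
    x₀ + Bᵀ *ᵥ ν - Bᵀ *ᵥ (activeMultiplier B A S (reduced B A ν x₀) +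
      (A : Set (Fin K)).indicator ν) = activeResidual B A S (reduced B A ν x₀) := by
  rw [activeResidual, mulVec_eq_reduced_add B A, Matrix.mulVec_add]
  abel

theorem InRegion.isKKT (hS : S.PosDef) (hA : RowsIndependent B A) (hAJ : A ⊆ J) (hIA : I ⊆ A)
    (h : InRegion B S J I A ν (reduced B A ν x₀)) :
    IsKKT B S J I (x₀ + Bᵀ *ᵥ ν) (activeMultiplier B A S (reduced B A ν x₀) +
      (A : Set (Fin K)).indicator ν) := by
  have hout {j : Fin K} (hj : j ∉ A) : (activeMultiplier B A S (reduced B A ν x₀) +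
      (A : Set (Fin K)).indicator ν) j = 0 := by
    simp [activeMultiplier_of_notMem hA hS _ hj, hj]
  have hin {j : Fin K} (hj : j ∈ A) := mulVec_activeResidual_of_mem hA hS (reduced B A ν x₀) hj
  constructor
  · exact fun j hj => hout fun h => hj (hAJ h)
  · intro j hj
    by_cases hjA : j ∈ A
    · simpa [hjA] using (h.multiplier_pos j hjA hj).le
    · exact (hout hjA).ge
  · intro j hj
    rw [sub_eq_activeResidual]
    by_cases hjA : j ∈ A
    · exact (hin hjA).le
    · exact (h.slack_neg j hj hjA).le
  · intro j hj
    rw [sub_eq_activeResidual]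
    exact hin (hIA hj)
  · intro j
    rw [sub_eq_activeResidual]
    by_cases hjA : j ∈ A
    · rw [hin hjA, mul_zero]
    · rw [hout hjA, zero_mul]

/-- The residual is unique, and within `J` the active set is recovered from it as the set of
vanishing slacks. -/
theorem InRegion.active_unique {A' : Finset (Fin K)} (hS : S.PosDef) (hJ : RowsIndependent B J)
    (hAJ : A ⊆ J) (hIA : I ⊆ A) (hAJ' : A' ⊆ J) (hIA' : I ⊆ A')
    (h : InRegion B S J I A ν (reduced B A ν x₀))
    (h' : InRegion B S J I A' ν (reduced B A' ν x₀)) : A = A' := by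
  have hr := (h.isKKT hS (hJ.mono hAJ) hAJ hIA).residual_unique hS
    (h'.isKKT hS (hJ.mono hAJ') hAJ' hIA')
  rw [sub_eq_activeResidual, sub_eq_activeResidual] at hr
  have key {A A' : Finset (Fin K)} (hAJ : A ⊆ J)
      (h' : InRegion B S J I A' ν (reduced B A' ν x₀))
      (hr : activeResidual B A S (reduced B A ν x₀) =
        activeResidual B A' S (reduced B A' ν x₀)) : A ⊆ A' := fun j hj => by
    by_contra hj'
    have h1 := h'.slack_neg j (hAJ hj) hj'
    rw [← hr, mulVec_activeResidual_of_mem (hJ.mono hAJ) hS _ hj] at h1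
    exact lt_irrefl _ h1
  exact (key hAJ h' hr).antisymm (key hAJ' h hr.symm)

/-- A solution of the optimality conditions yields an active set, provided that no slack outside
the active set vanishes. -/
theorem IsKKT.exists_inRegion {l : Fin K → ℝ} (hS : S.PosDef) (hJ : RowsIndependent B J)
    (hIJ : I ⊆ J) (hl : IsKKT B S J I (x₀ + Bᵀ *ᵥ ν) l)
    (hne : ∀ A ⊆ J, A.card ≠ m → ∀ j ∉ A,
      (B *ᵥ (S⁻¹ *ᵥ activeResidual B A S (reduced B A ν x₀))) j ≠ 0)
    (hcard : ∀ A ⊆ J, A.card = m → A = J) :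
    ∃ A, I ⊆ A ∧ A ⊆ J ∧ InRegion B S J I A ν (reduced B A ν x₀) := by
  classical
  -- Free rows always count as active, the others when their multiplier is positive; `hne` excludes
  -- the degenerate case of a zero multiplier with a zero slack.
  set A : Finset (Fin K) := I ∪ J.filter fun j => 0 < l j with hAdef
  have hAJ : A ⊆ J := Finset.union_subset hIJ (Finset.filter_subset _ _)
  have hIA : I ⊆ A := Finset.subset_union_left
  have hlpos : ∀ j ∈ A, j ∉ I → 0 < l j := by
    intro j hj hjI
    rw [hAdef, Finset.mem_union] at hj
    exact (Finset.mem_filter.1 (hj.resolve_left hjI)).2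
  have hlA : ∀ j ∉ A, l j = 0 := fun j hj => by
    by_cases hjJ : j ∈ J
    · have h1 : j ∉ I := fun h => hj (hIA h)
      refine le_antisymm (not_lt.1 fun h => hj ?_) (hl.nonneg j h1)
      exact Finset.mem_union_right _ (Finset.mem_filter.2 ⟨hjJ, h⟩)
    · exact hl.supp j hjJ
  have hres : reduced B A ν x₀ - Bᵀ *ᵥ (l - (A : Set (Fin K)).indicator ν) =
      x₀ + Bᵀ *ᵥ ν - Bᵀ *ᵥ l := by
    rw [mulVec_eq_reduced_add B A, Matrix.mulVec_sub]
    abel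
  have hact : activeMultiplier B A S (reduced B A ν x₀) = l - (A : Set (Fin K)).indicator ν := by
    refine activeMultiplier_eq (hJ.mono hAJ) hS (fun j hj => by simp [hlA j hj, hj])
      fun j hj => ?_
    rw [hres]
    by_cases hjI : j ∈ I
    · exact hl.slack_eq_zero j hjI
    · exact (mul_eq_zero.1 (hl.complementary j)).resolve_left (hlpos j hj hjI).ne'
  refine ⟨A, hIA, hAJ, fun j hj hjI => ?_, fun j hj hjA => ?_, fun hc j hj => ?_⟩
  · rw [hact]
    simpa [hj] using hlpos j hj hjI
  · have hc : A.card ≠ m := fun h => hjA (hcard A hAJ h ▸ hj)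
    refine lt_of_le_of_ne ?_ (hne A hAJ hc j hjA)
    rw [activeResidual, hact, hres]
    exact hl.slack_nonpos j hj
  · exact hne A hAJ hc j fun h => hj (hAJ h)

/-- By dimension the rows in `A` span the space, so `g = B' a` with `a` supported in `A`, and `g · g
= a · B g = 0`. -/
theorem eq_zero_of_mulVec_eq_zero (hA : RowsIndependent B A) (hcard : A.card = m)
    {g : Fin m → ℝ} (hg : ∀ j ∈ A, (B *ᵥ g) j = 0) : g = 0 := by
  classical
  let C : Matrix A (Fin m) ℝ := B.submatrix (↑) id
  have hC (a : A → ℝ) : Cᵀ *ᵥ a = Bᵀ *ᵥ fun j => if h : j ∈ A then a ⟨j, h⟩ else 0 := by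
    ext i
    simp only [Matrix.mulVec, dotProduct, Matrix.transpose_apply, C, Matrix.submatrix_apply, id]
    rw [← Finset.sum_subset (Finset.subset_univ A) (fun j _ hj => by simp [hj]),
      ← Finset.sum_coe_sort A]
    simp
  have hinj : Function.Injective Cᵀ.mulVecLin := by
    refine (injective_iff_map_eq_zero _).2 fun a ha => ?_
    have h1 : Cᵀ *ᵥ a = 0 := ha
    rw [hC] at h1
    have h2 := hA _ (fun j hj => by simp [hj]) h1
    ext j
    simpa using congrFun h2 j.1
  have hsurj := (LinearMap.injective_iff_surjective_of_finrank_eq_finrank (by simp [hcard])).1 hinj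
  obtain ⟨a, ha⟩ := hsurj g
  have ha' : Cᵀ *ᵥ a = g := ha
  have : g ⬝ᵥ g = 0 := by
    nth_rewrite 1 [← ha', hC]
    rw [transpose_mulVec_dotProduct]
    refine Finset.sum_eq_zero fun j _ => ?_
    by_cases hj : j ∈ A
    · rw [hg j hj, mul_zero]
    · simp [hj]
  exact dotProduct_self_eq_zero.1 this

theorem activeResidual_eq_zero (hA : RowsIndependent B A) (hS : S.PosDef) (hcard : A.card = m)
    (x : Fin m → ℝ) : activeResidual B A S x = 0 := by
  have h := eq_zero_of_mulVec_eq_zero hA hcard fun j hj => mulVec_activeResidual_of_mem hA hS x hj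
  have := congrArg (S *ᵥ ·) h
  simpa [Matrix.mulVec_mulVec, Matrix.mul_nonsing_inv _
    ((Matrix.isUnit_iff_isUnit_det S).1 hS.isUnit)] using this

end Region

/-! ### From an active set to membership in the confidence set. -/

section Complement

variable {K : ℕ} {B₂ : Matrix (Fin K) (Fin (K - 1)) ℝ}

/-- Any proper subset of the rows of `B₂` is linearly independent. -/
theorem IsComplement.rowsIndependent (hB : IsComplement B₂) {A : Finset (Fin K)}
    (hA : A ≠ Finset.univ) : RowsIndependent B₂ A := by
  intro l hl hBl
  obtain ⟨j₀, hj₀⟩ : ∃ j, j ∉ A := by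
    by_contra h
    push Not at h
    exact hA (Finset.eq_univ_iff_forall.2 h)
  have hK : 1 ≤ K := j₀.pos
  have hsurj : Function.Surjective B₂ᵀ.mulVecLin := fun v => ⟨B₂ *ᵥ v, by
    rw [Matrix.mulVecLin_apply, Matrix.mulVec_mulVec, hB.1, Matrix.one_mulVec]⟩
  -- The kernel of `B₂'` is the line of constant vectors, so a kernel vector with one zero entry is
  -- zero.
  have hker : Module.finrank ℝ (LinearMap.ker B₂ᵀ.mulVecLin) = 1 := by
    have h1 := LinearMap.finrank_range_add_finrank_ker B₂ᵀ.mulVecLin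
    rw [LinearMap.range_eq_top.2 hsurj, finrank_top] at h1
    simp only [Module.finrank_fintype_fun_eq_card, Fintype.card_fin] at h1
    omega
  have hone : (fun _ => 1 : Fin K → ℝ) ∈ LinearMap.ker B₂ᵀ.mulVecLin := by
    rw [LinearMap.mem_ker, Matrix.mulVecLin_apply]; exact hB.2
  have hne : (⟨_, hone⟩ : LinearMap.ker B₂ᵀ.mulVecLin) ≠ 0 := fun h =>
    one_ne_zero (congrFun (congrArg Subtype.val h) j₀)
  obtain ⟨c, hc⟩ := (finrank_eq_one_iff_of_nonzero' _ hne).1 hker ⟨l, hBl⟩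
  have hlc (j : Fin K) : c = l j := by simpa using congrFun (congrArg Subtype.val hc) j
  have hc0 : c = 0 := (hlc j₀).trans (hl j₀ hj₀)
  ext j
  rw [← hlc j, hc0, Pi.zero_apply]

/-- A point belongs to the confidence set if some active set satisfies the optimality conditions
with strict complementarity and the test statistic is below the corresponding critical value. -/
theorem mem_confidenceSet (hB : IsComplement B₂) {n : ℕ} (hn : 1 ≤ n) {α : ℝ}
    {f : (Fin K → ℝ) → Fin (K - 1) → ℝ}
    {Ω : (Fin K → ℝ) → Matrix (Fin (K - 1)) (Fin (K - 1)) ℝ} {w : Fin K → ℝ}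
    (hw : w ∈ stdSimplex ℝ (Fin K)) (hΩ : (Ω w).PosDef) {J A : Finset (Fin K)}
    (hJ : ∀ j, j ∈ J ↔ w j = 0) (hAJ : A ⊆ J) {ν : Fin K → ℝ}
    {x₀ : Fin (K - 1) → ℝ} (hf : Real.sqrt n • f w = x₀ + B₂ᵀ *ᵥ ν)
    (hreg : InRegion B₂ (Ω w) J ∅ A ν (reduced B₂ A ν x₀))
    (hT : sqNorm (Ω w) (activeResidual B₂ A (Ω w) (reduced B₂ A ν x₀)) ≤
      chiSqQuantile (max (K - 1 - A.card) 1) (1 - α)) :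
    w ∈ confidenceSet B₂ n α f Ω := by
  have hJu : J ≠ Finset.univ := by
    rintro rfl
    have : ∑ j, w j = 0 := Finset.sum_eq_zero fun j _ => (hJ j).1 (Finset.mem_univ j)
    rw [hw.2] at this
    exact one_ne_zero this
  have hAu : A ≠ Finset.univ := fun h => hJu (Finset.univ_subset_iff.1 (h ▸ hAJ))
  have hindA := hB.rowsIndependent hAu
  have hs : 0 < Real.sqrt n := Real.sqrt_pos.2 (by exact_mod_cast hn)
  set s := Real.sqrt n with hsdef
  set r := activeResidual B₂ A (Ω w) (reduced B₂ A ν x₀) with hr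
  set l₀ := activeMultiplier B₂ A (Ω w) (reduced B₂ A ν x₀) + (A : Set (Fin K)).indicator ν
  have hk := hreg.isKKT hΩ hindA hAJ (Finset.empty_subset A)
  -- The optimality conditions concern `√n f̂`, the procedure uses `f̂`. Feasible multipliers form a
  -- cone, so division by `√n` preserves minimisers, and the factor `n` in the statistic undoes the
  -- scaling.
  have hres : f w - B₂ᵀ *ᵥ (s⁻¹ • l₀) = s⁻¹ • r := by
    rw [hr, ← sub_eq_activeResidual, ← hf, smul_sub, smul_smul, inv_mul_cancel₀ hs.ne', one_smul,
      Matrix.mulVec_smul]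
  have hmult : ∀ l ∈ multipliers w, ∀ j ∉ J, l j = 0 := by
    intro l hl j hj
    have h0 : ∀ i ∈ Finset.univ, 0 ≤ w i * l i := fun i _ => mul_nonneg (hw.1 i) (hl.2 i)
    have h1 := (Finset.sum_eq_zero_iff_of_nonneg h0).1 hl.1 j (Finset.mem_univ j)
    exact (mul_eq_zero.1 h1).resolve_left fun h => hj ((hJ j).2 h)
  have hl₀nn : ∀ j, 0 ≤ l₀ j := fun j => hk.nonneg j (Finset.notMem_empty j)
  have hfeas : s⁻¹ • l₀ ∈ multipliers w := by
    refine ⟨Finset.sum_eq_zero fun j _ => ?_, fun j => mul_nonneg (by positivity) (hl₀nn j)⟩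
    by_cases hj : j ∈ J
    · rw [(hJ j).1 hj, zero_mul]
    · rw [Pi.smul_apply, show l₀ j = 0 from hk.supp j hj, smul_zero, mul_zero]
  refine ⟨hw, hΩ, s⁻¹ • l₀, ⟨hfeas, fun l hl => ?_⟩, ?_⟩
  · have h1 := hk.sqNorm_le hΩ (l' := s • l) (fun j hj => by simp [hmult l hl j hj])
      fun j => mul_nonneg hs.le (hl.2 j)
    have h2 : f w - B₂ᵀ *ᵥ l = s⁻¹ • (x₀ + B₂ᵀ *ᵥ ν - B₂ᵀ *ᵥ (s • l)) := by
      rw [← hf, Matrix.mulVec_smul, ← smul_sub, smul_smul, inv_mul_cancel₀ hs.ne', one_smul]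
    change sqNorm (Ω w) (f w - B₂ᵀ *ᵥ (s⁻¹ • l₀)) ≤ sqNorm (Ω w) (f w - B₂ᵀ *ᵥ l)
    rw [hres, h2, sqNorm_smul, sqNorm_smul, hr, ← sub_eq_activeResidual]
    exact mul_le_mul_of_nonneg_left h1 (by positivity)
  · have hstat : (n : ℝ) * sqNorm (Ω w) (s⁻¹ • r) = sqNorm (Ω w) r := by
      rw [sqNorm_smul, ← mul_assoc, inv_pow, hsdef, Real.sq_sqrt (Nat.cast_nonneg n),
        mul_inv_cancel₀ (by positivity), one_mul]
    rw [hres, hstat]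
    have hzero : zeroCount B₂ (f w) (Ω w) (s⁻¹ • l₀) =
        {j : Fin K | (B₂ *ᵥ ((Ω w)⁻¹ *ᵥ r)) j = 0}.ncard := by
      rw [zeroCount, hres]
      congr 1
      ext j
      simp [Matrix.mulVec_smul, hs.ne']
    -- If `A.card = K - 1`, all `K` slacks vanish and both sides are truncated to one degree of
    -- freedom. Otherwise strict complementarity makes `A` exactly the set of zeros.
    have hdf : max (K - 1 - zeroCount B₂ (f w) (Ω w) (s⁻¹ • l₀)) 1 = max (K - 1 - A.card) 1 := by
      rw [hzero]
      by_cases hc : A.card = K - 1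
      · have hr0 : r = 0 := activeResidual_eq_zero hindA hΩ hc _
        rw [hr0, hc]
        simp [Set.ncard_univ]
      · congr 2
        rw [← Set.ncard_coe_finset A]
        congr 1
        ext j
        simp only [Set.mem_ofPred_eq, SetLike.mem_coe]
        refine ⟨fun h => ?_, fun h => mulVec_activeResidual_of_mem hindA hΩ _ h⟩
        by_contra hj
        by_cases hjJ : j ∈ J
        · exact (hreg.slack_neg j hjJ hj).ne h
        · exact hreg.slack_ne hc j hjJ h
    rw [criticalValue, hdf]
    exact hT

end Complement

/-- This covers active sets of full size, where the statistic is zero. A nonpositive quantile would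
leave no mass below it. -/
theorem chiSqQuantile_pos {k : ℕ} (hk : 1 ≤ k) {p : ℝ} (hp : p ∈ Set.Ioo (0 : ℝ) 1) :
    0 < chiSqQuantile k p := by
  by_contra hc
  have h := le_chiSq_Iio_chiSqQuantile hk hp
  have h0 : chiSq k (Set.Iio (chiSqQuantile k p)) = 0 := by
    rw [chiSq, Measure.map_apply (by fun_prop) measurableSet_Iio]
    convert measure_empty (μ := stdNormal k)
    ext z
    have : 0 ≤ ∑ i, z i ^ 2 := by positivity
    simp only [Set.mem_preimage, Set.mem_Iio, Set.mem_empty_iff_false, iff_false]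
    linarith
  rw [h0, nonpos_iff_eq_zero, ENNReal.ofReal_eq_zero] at h
  exact absurd hp.1 (not_lt.2 h)

/-! ### The limit experiment: Gaussian data with known variance. -/

section Whitening

open scoped RealInnerProductSpace

variable {K m : ℕ} {B : Matrix (Fin K) (Fin m) ℝ} {H : Matrix (Fin m) (Fin m) ℝ}
  {A J I : Finset (Fin K)} {ν : Fin K → ℝ}

/-- The transformation `x ↦ H⁻¹ x` to white noise, with values in Euclidean space. -/
noncomputable def whiten (H : Matrix (Fin m) (Fin m) ℝ) (x : Fin m → ℝ) :
    EuclideanSpace ℝ (Fin m) :=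
  WithLp.toLp 2 (H⁻¹ *ᵥ x)

theorem isUnit_det_of_posDef_mul_self (hS : (H * H).PosDef) : IsUnit H.det := by
  have : IsUnit (H * H).det := (Matrix.isUnit_iff_isUnit_det _).1 hS.isUnit
  rw [Matrix.det_mul] at this
  exact isUnit_of_mul_isUnit_left this

theorem whiten_add (x y : Fin m → ℝ) : whiten H (x + y) = whiten H x + whiten H y := by
  simp [whiten, Matrix.mulVec_add]

theorem whiten_sub (x y : Fin m → ℝ) : whiten H (x - y) = whiten H x - whiten H y := by
  simp [whiten, Matrix.mulVec_sub]

theorem whiten_mulVec (hS : (H * H).PosDef) (z : EuclideanSpace ℝ (Fin m)) :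
    whiten H (H *ᵥ z.ofLp) = z := by
  rw [whiten, Matrix.mulVec_mulVec, Matrix.nonsing_inv_mul _ (isUnit_det_of_posDef_mul_self hS),
    Matrix.one_mulVec]

theorem inner_whiten (hH : Hᵀ = H) (x y : Fin m → ℝ) :
    ⟪whiten H x, whiten H y⟫ = x ⬝ᵥ ((H * H)⁻¹ *ᵥ y) := by
  have hHinv : (H⁻¹)ᵀ = H⁻¹ := by rw [Matrix.transpose_nonsing_inv, hH]
  rw [whiten, whiten, EuclideanSpace.inner_toLp_toLp, Matrix.mul_inv_rev, ← Matrix.mulVec_mulVec,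
    Matrix.dotProduct_mulVec x, ← Matrix.mulVec_transpose, hHinv, dotProduct_comm]
  rfl

theorem norm_sq_whiten (hH : Hᵀ = H) (x : Fin m → ℝ) : ‖whiten H x‖ ^ 2 = sqNorm (H * H) x := by
  rw [← real_inner_self_eq_norm_sq, inner_whiten hH, sqNorm]

theorem inner_whiten_row (hH : Hᵀ = H) (j : Fin K) (x : Fin m → ℝ) :
    ⟪whiten H (B j), whiten H x⟫ = (B *ᵥ ((H * H)⁻¹ *ᵥ x)) j :=
  inner_whiten hH _ _

theorem whiten_transpose_mulVec (l : Fin K → ℝ) :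
    whiten H (Bᵀ *ᵥ l) = ∑ j, l j • whiten H (B j) := by
  have : Bᵀ *ᵥ l = ∑ j, l j • B j := by
    ext i
    simp [Matrix.mulVec, dotProduct, mul_comm]
  simp only [this, whiten, Matrix.mulVec_sum, Matrix.mulVec_smul]
  simp

/-- The orthogonal complement of the whitened rows in `A`. -/
noncomputable def faceSpace (B : Matrix (Fin K) (Fin m) ℝ) (H : Matrix (Fin m) (Fin m) ℝ)
    (A : Finset (Fin K)) : Submodule ℝ (EuclideanSpace ℝ (Fin m)) :=
  (Submodule.span ℝ (Set.range fun j : A => whiten H (B j)))ᗮ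

theorem mem_faceSpace {u : EuclideanSpace ℝ (Fin m)} :
    u ∈ faceSpace B H A ↔ ∀ j ∈ A, ⟪whiten H (B j), u⟫ = 0 := by
  rw [faceSpace, Submodule.mem_orthogonal]
  constructor
  · exact fun h j hj => h _ (Submodule.subset_span ⟨⟨j, hj⟩, rfl⟩)
  · intro h v hv
    induction hv using Submodule.span_induction with
    | mem x hx => obtain ⟨j, rfl⟩ := hx; exact h j j.2
    | zero => simp
    | add x y _ _ hx hy => rw [inner_add_left, hx, hy, add_zero]
    | smul a x _ hx => rw [inner_smul_left, hx, mul_zero]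

/-- These are the degrees of freedom of the statistic; whitening keeps the rows independent. -/
theorem finrank_faceSpace (hS : (H * H).PosDef) (hA : RowsIndependent B A) :
    Module.finrank ℝ (faceSpace B H A) = m - A.card := by
  classical
  have hli : LinearIndependent ℝ fun j : A => whiten H (B j) := by
    rw [Fintype.linearIndependent_iff]
    intro g hg
    set l : Fin K → ℝ := fun j => if h : j ∈ A then g ⟨j, h⟩ else 0 with hl
    have h1 : whiten H (Bᵀ *ᵥ l) = 0 := by
      rw [whiten_transpose_mulVec, ← Finset.sum_subset (Finset.subset_univ A)
        (fun j _ hj => by simp [hl, hj]), ← Finset.sum_coe_sort A, ← hg]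
      simp [hl]
    have h2 : Bᵀ *ᵥ l = 0 := by
      have h3 : H⁻¹ *ᵥ (Bᵀ *ᵥ l) = 0 := by simpa [whiten] using h1
      have := congrArg (H *ᵥ ·) h3
      rw [Matrix.mulVec_mulVec, Matrix.mul_nonsing_inv _ (isUnit_det_of_posDef_mul_self hS),
        Matrix.one_mulVec, Matrix.mulVec_zero] at this
      exact this
    have h3 := hA l (fun j hj => by simp [hl, hj]) h2
    intro j
    simpa [hl] using congrFun h3 j
  have h1 := finrank_span_eq_card hli
  have h2 := Submodule.finrank_add_finrank_orthogonal
    (Submodule.span ℝ (Set.range fun j : A => whiten H (B j)))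
  rw [h1, Fintype.card_coe, finrank_euclideanSpace_fin] at h2
  exact Nat.eq_sub_of_add_eq' h2

/-- The normal equations say that the whitened residual is orthogonal to the active rows, and what
was removed is a combination of these rows. -/
theorem starProjection_whiten (hH : Hᵀ = H) (hS : (H * H).PosDef) (hA : RowsIndependent B A)
    (x : Fin m → ℝ) : (faceSpace B H A).starProjection (whiten H x) =
      whiten H (activeResidual B A (H * H) x) := by
  refine Submodule.eq_starProjection_of_mem_orthogonal ?_ ?_
  · rw [mem_faceSpace]
    intro j hj
    rw [inner_whiten_row hH]
    exact mulVec_activeResidual_of_mem hA hS x hj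
  · rw [← whiten_sub, activeResidual, sub_sub_cancel, whiten_transpose_mulVec]
    refine Submodule.sum_mem _ fun j _ => ?_
    by_cases hj : j ∈ A
    · refine Submodule.smul_mem _ _ ((Submodule.mem_orthogonal' _ _).2 fun u hu => ?_)
      exact mem_faceSpace.1 hu j hj
    · rw [activeMultiplier_of_notMem hA hS x hj, zero_smul]
      exact Submodule.zero_mem _

theorem continuous_activeMultiplier (B : Matrix (Fin K) (Fin m) ℝ) (A : Finset (Fin K))
    (S : Matrix (Fin m) (Fin m) ℝ) : Continuous (activeMultiplier B A S) := by
  refine continuous_const.matrix_mulVec (continuous_pi fun i => ?_)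
  by_cases hi : i ∈ A
  · simp only [hi, if_true]
    exact (continuous_apply i).comp (continuous_const.matrix_mulVec
      (continuous_const.matrix_mulVec continuous_id))
  · simp only [hi, if_false]
    exact continuous_const

theorem continuous_activeResidual (B : Matrix (Fin K) (Fin m) ℝ) (A : Finset (Fin K))
    (S : Matrix (Fin m) (Fin m) ℝ) : Continuous (activeResidual B A S) :=
  continuous_id.sub (continuous_const.matrix_mulVec (continuous_activeMultiplier B A S))

/-- The multipliers ignore noise in the face space, so they are functions of the orthogonal
component alone and independent of the residual. -/
theorem activeMultiplier_sub_of_mem_faceSpace (hH : Hᵀ = H) (hS : (H * H).PosDef)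
    (hA : RowsIndependent B A) {v : EuclideanSpace ℝ (Fin m)} (hv : v ∈ faceSpace B H A)
    (x : Fin m → ℝ) :
    activeMultiplier B A (H * H) (x - H *ᵥ v.ofLp) = activeMultiplier B A (H * H) x := by
  refine activeMultiplier_eq hA hS (fun j hj => activeMultiplier_of_notMem hA hS x hj)
    fun j hj => ?_
  have h1 := mulVec_activeResidual_of_mem hA hS x hj
  have h2 := mem_faceSpace.1 hv j hj
  rw [← whiten_mulVec hS v, inner_whiten_row hH] at h2
  rw [sub_right_comm, ← activeResidual, Matrix.mulVec_sub, Matrix.mulVec_sub, Pi.sub_apply, h1, h2,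
    sub_zero]

theorem measurableSet_inRegion (B : Matrix (Fin K) (Fin m) ℝ) (S : Matrix (Fin m) (Fin m) ℝ)
    (J I A : Finset (Fin K)) (ν : Fin K → ℝ) :
    MeasurableSet {x : Fin m → ℝ | InRegion B S J I A ν x} := by
  have hs (j : Fin K) : Continuous fun x => (B *ᵥ (S⁻¹ *ᵥ activeResidual B A S x)) j :=
    (continuous_apply j).comp (continuous_const.matrix_mulVec
      (continuous_const.matrix_mulVec (continuous_activeResidual B A S)))
  have hm (j : Fin K) : Continuous fun x => activeMultiplier B A S x j + ν j :=
    ((continuous_apply j).comp (continuous_activeMultiplier B A S)).add continuous_const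
  have : {x : Fin m → ℝ | InRegion B S J I A ν x} =
      (⋂ j, ⋂ (_ : j ∈ A), ⋂ (_ : j ∉ I), {x | 0 < activeMultiplier B A S x j + ν j}) ∩
      ((⋂ j, ⋂ (_ : j ∈ J), ⋂ (_ : j ∉ A), {x | (B *ᵥ (S⁻¹ *ᵥ activeResidual B A S x)) j < 0}) ∩
      (⋂ (_ : A.card ≠ m), ⋂ j, ⋂ (_ : j ∉ J),
        {x | (B *ᵥ (S⁻¹ *ᵥ activeResidual B A S x)) j ≠ 0})) := by
    ext x
    simp only [Set.mem_inter_iff, Set.mem_iInter, Set.mem_ofPred_eq]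
    exact ⟨fun h => ⟨h.1, h.2, h.3⟩, fun h => ⟨h.1, h.2.1, h.2.2⟩⟩
  rw [this]
  refine .inter ?_ (.inter ?_ ?_)
  · exact .iInter fun j => .iInter fun _ => .iInter fun _ =>
      measurableSet_lt measurable_const (hm j).measurable
  · exact .iInter fun j => .iInter fun _ => .iInter fun _ =>
      measurableSet_lt (hs j).measurable measurable_const
  · exact .iInter fun _ => .iInter fun j => .iInter fun _ =>
      (measurableSet_eq_fun (hs j).measurable measurable_const).compl

theorem stdNormal_eq_stdGaussian (s : Set (Fin m → ℝ)) :
    stdNormal m s = stdGaussian (EuclideanSpace ℝ (Fin m)) {z | z.ofLp ∈ s} := by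
  rw [← map_pi_eq_stdGaussian]
  exact ((MeasurableEquiv.toLp 2 (Fin m → ℝ)).map_apply (μ := stdNormal m)
    {z : EuclideanSpace ℝ (Fin m) | z.ofLp ∈ s}).symm

theorem whiten_reduced (hS : (H * H).PosDef) (z : EuclideanSpace ℝ (Fin m)) :
    whiten H (reduced B A ν (H *ᵥ z.ofLp)) =
      z + whiten H (Bᵀ *ᵥ (A : Set (Fin K))ᶜ.indicator ν) := by
  rw [reduced, whiten_add, whiten_mulVec hS]

/-- On the event that `A` is the active set, the test statistic is stochastically dominated by a
`χ²` variable. -/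
theorem mul_stdNormal_inRegion_le (hH : Hᵀ = H) (hS : (H * H).PosDef) (hA : RowsIndependent B A)
    (hcard : A.card < m) (hν : ∀ j, 0 ≤ ν j) (hνJ : ∀ j ∉ J, ν j = 0)
    {c : ℝ} {p : ℝ≥0∞} (hp : p ≤ chiSq (m - A.card) (Set.Iio c)) :
    p * stdNormal m {z | InRegion B (H * H) J I A ν (reduced B A ν (H *ᵥ z))} ≤
      stdNormal m {z | InRegion B (H * H) J I A ν (reduced B A ν (H *ᵥ z)) ∧
        sqNorm (H * H) (activeResidual B A (H * H) (reduced B A ν (H *ᵥ z))) < c} := by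
  set L := faceSpace B H A with hLdef
  have hrank : Module.finrank ℝ L = m - A.card := finrank_faceSpace hS hA
  have hL : L ≠ ⊥ := by
    intro h
    rw [h, finrank_bot] at hrank
    omega
  set μ := whiten H (Bᵀ *ᵥ (A : Set (Fin K))ᶜ.indicator ν) with hμdef
  -- `F` carries the slack conditions, on the projection to `L`; `N` below carries the multiplier
  -- conditions, on the orthogonal component.
  set F : Set (EuclideanSpace ℝ (Fin m)) := (⋂ j, ⋂ (_ : j ∈ J), ⋂ (_ : j ∉ A),
    {u | ⟪whiten H (B j), u⟫ < 0}) ∩ (⋂ j, ⋂ (_ : j ∉ J), {u | ⟪whiten H (B j), u⟫ ≠ 0}) with hFdef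
  set N : Set (EuclideanSpace ℝ (Fin m)) := ⋂ j, ⋂ (_ : j ∈ A), ⋂ (_ : j ∉ I),
    {v | 0 < activeMultiplier B A (H * H) (reduced B A ν (H *ᵥ v.ofLp)) j + ν j} with hNdef
  have hF : MeasurableSet F := by
    refine .inter (.iInter fun j => .iInter fun _ => .iInter fun _ => ?_)
      (.iInter fun j => .iInter fun _ => ?_)
    · exact measurableSet_lt (by fun_prop) measurable_const
    · exact (measurableSet_eq_fun (by fun_prop) measurable_const).compl
  have hN : MeasurableSet N := by
    refine .iInter fun j => .iInter fun _ => .iInter fun _ => ?_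
    refine measurableSet_lt measurable_const (Continuous.measurable ?_)
    refine ((continuous_apply j).comp ((continuous_activeMultiplier B A (H * H)).comp ?_)).add
      continuous_const
    unfold reduced
    exact (continuous_const.matrix_mulVec (PiLp.continuous_ofLp 2 _)).add continuous_const
  have hproj (z : EuclideanSpace ℝ (Fin m)) : L.starProjection (z + μ) =
      whiten H (activeResidual B A (H * H) (reduced B A ν (H *ᵥ z.ofLp))) := by
    rw [← starProjection_whiten hH hS hA, whiten_reduced hS]
  have hreg (z : EuclideanSpace ℝ (Fin m)) :
      InRegion B (H * H) J I A ν (reduced B A ν (H *ᵥ z.ofLp)) ↔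
        L.starProjection (z + μ) ∈ F ∧ z - L.starProjection z ∈ N := by
    have hmult : activeMultiplier B A (H * H)
        (reduced B A ν (H *ᵥ (z - L.starProjection z).ofLp)) =
        activeMultiplier B A (H * H) (reduced B A ν (H *ᵥ z.ofLp)) := by
      have hmem : L.starProjection z ∈ faceSpace B H A := L.starProjection_apply_mem z
      rw [← activeMultiplier_sub_of_mem_faceSpace hH hS hA hmem
        (reduced B A ν (H *ᵥ z.ofLp)), reduced, reduced,
        WithLp.ofLp_sub, Matrix.mulVec_sub, add_sub_right_comm]
    rw [hproj]
    simp only [hFdef, hNdef, Set.mem_inter_iff, Set.mem_iInter, Set.mem_ofPred_eq,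
      inner_whiten_row hH, hmult]
    exact ⟨fun h => ⟨⟨h.2, h.3 hcard.ne⟩, h.1⟩, fun h => ⟨h.2, h.1.1, fun _ => h.1.2⟩⟩
  have hcone : ∀ u ∈ F, ∀ t : ℝ, 0 < t → t • u ∈ F := by
    intro u hu t ht
    simp only [hFdef, Set.mem_inter_iff, Set.mem_iInter, Set.mem_ofPred_eq, inner_smul_right] at hu ⊢
    exact ⟨fun j hj hjA => mul_neg_of_pos_of_neg ht (hu.1 j hj hjA),
      fun j hj => mul_ne_zero ht.ne' (hu.2 j hj)⟩
  -- The mean is a combination of whitened rows in `J` outside `A` with weights `ν j ≥ 0`, and on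
  -- `F` each of these rows has negative inner product with `u`.
  have hμ : ∀ u ∈ F, u ∈ L → ⟪μ, u⟫ ≤ 0 := by
    intro u hu huL
    simp only [hFdef, Set.mem_inter_iff, Set.mem_iInter, Set.mem_ofPred_eq] at hu
    rw [hμdef, whiten_transpose_mulVec, sum_inner]
    refine Finset.sum_nonpos fun j _ => ?_
    rw [real_inner_smul_left]
    by_cases hjA : j ∈ A
    · simp [hjA]
    · by_cases hjJ : j ∈ J
      · exact mul_nonpos_of_nonneg_of_nonpos (by simpa [hjA] using hν j) (hu.1 j hjJ hjA).le
      · simp [hjA, hνJ j hjJ]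
  have hp' : p ≤ stdGaussian L {u | ‖u‖ ^ 2 < c} := by
    rw [← stdGaussian_norm_sq_eq_chiSq hrank measurableSet_Iio] at hp
    exact hp
  have key := mul_stdGaussian_face_le hL hF hN hcone hμ hp'
  rw [stdNormal_eq_stdGaussian, stdNormal_eq_stdGaussian]
  simp only [Set.mem_ofPred_eq, hreg]
  refine key.trans (measure_mono fun z hz => ?_)
  simp only [Set.mem_ofPred_eq] at hz ⊢
  refine ⟨⟨hz.1.1, hz.2⟩, ?_⟩
  rw [← norm_sq_whiten hH, ← hproj]
  exact hz.1.2

/-- Almost surely no slack outside the active set vanishes. -/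
theorem stdNormal_slack_eq_zero (hH : Hᵀ = H) (hS : (H * H).PosDef) (hA : RowsIndependent B A)
    {j : Fin K} (hj : j ∉ A) (hAj : RowsIndependent B (insert j A)) (ν : Fin K → ℝ) :
    stdNormal m {z | (B *ᵥ ((H * H)⁻¹ *ᵥ
      activeResidual B A (H * H) (reduced B A ν (H *ᵥ z)))) j = 0} = 0 := by
  set L := faceSpace B H A with hLdef
  set μ := whiten H (Bᵀ *ᵥ (A : Set (Fin K))ᶜ.indicator ν) with hμdef
  -- The slack is affine in `z` with this vector as its linear part. It is nonzero because row `j`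
  -- is not in the span of the rows in `A`.
  have hne : L.starProjection (whiten H (B j)) ≠ 0 := by
    rw [starProjection_whiten hH hS hA]
    intro h0
    have h1 : activeResidual B A (H * H) (B j) = 0 := by
      by_contra hne
      have := PosDef.sqNorm_pos hS hne
      rw [← norm_sq_whiten hH, h0] at this
      simp at this
    rw [activeResidual, sub_eq_zero] at h1
    have h2 := hAj (Pi.single j 1 - activeMultiplier B A (H * H) (B j)) (fun i hi => by
      rw [Finset.mem_insert, not_or] at hi
      simp [hi.1, activeMultiplier_of_notMem hA hS _ hi.2]) (by
      rw [Matrix.mulVec_sub, ← h1, Matrix.mulVec_single_one]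
      exact sub_self _)
    have h3 := congrFun h2 j
    simp [activeMultiplier_of_notMem hA hS _ hj] at h3
  rw [stdNormal_eq_stdGaussian]
  refine measure_mono_null (fun z hz => ?_) (stdGaussian_hyperplane_eq_zero hne
    (-⟪L.starProjection (whiten H (B j)), μ⟫))
  simp only [Set.mem_ofPred_eq] at hz ⊢
  rw [← inner_whiten_row hH, ← starProjection_whiten hH hS hA, whiten_reduced hS,
    ← Submodule.inner_starProjection_left_eq_right, inner_add_right] at hz
  linarith

/-- Coverage in the limit experiment. -/
theorem le_stdNormal_iUnion_inRegion (hK : K = m + 1)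
    (hB : ∀ A : Finset (Fin K), A ≠ Finset.univ → RowsIndependent B A)
    (hH : Hᵀ = H) (hS : (H * H).PosDef) (hJ : J ≠ Finset.univ) (hIJ : I ⊆ J)
    (hν : ∀ j, 0 ≤ ν j) (hνJ : ∀ j ∉ J, ν j = 0) {q : ℝ} (hq : q ∈ Set.Ioo (0 : ℝ) 1) :
    ENNReal.ofReal q ≤ stdNormal m {z | ∃ A : Finset (Fin K), I ⊆ A ∧ A ⊆ J ∧
      InRegion B (H * H) J I A ν (reduced B A ν (H *ᵥ z)) ∧
      sqNorm (H * H) (activeResidual B A (H * H) (reduced B A ν (H *ᵥ z))) <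
        chiSqQuantile (max (m - A.card) 1) q} := by
  classical
  have hJcard : J.card ≤ m := by
    have := Finset.card_lt_card (Finset.ssubset_univ_iff.2 hJ)
    rw [Finset.card_univ, Fintype.card_fin] at this
    omega
  have hAu : ∀ A ⊆ J, A ≠ Finset.univ := fun A hA h => hJ (Finset.univ_subset_iff.1 (h ▸ hA))
  set 𝒜 : Finset (Finset (Fin K)) := J.powerset.filter (I ⊆ ·)
  have h𝒜 {A : Finset (Fin K)} : A ∈ 𝒜 ↔ A ⊆ J ∧ I ⊆ A := by simp [𝒜]
  set R : Finset (Fin K) → Set (Fin m → ℝ) := fun A =>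
    {z | InRegion B (H * H) J I A ν (reduced B A ν (H *ᵥ z))} with hR
  set G : Finset (Fin K) → Set (Fin m → ℝ) := fun A =>
    {z | InRegion B (H * H) J I A ν (reduced B A ν (H *ᵥ z)) ∧
      sqNorm (H * H) (activeResidual B A (H * H) (reduced B A ν (H *ᵥ z))) <
        chiSqQuantile (max (m - A.card) 1) q} with hG
  have hred (A : Finset (Fin K)) : Continuous fun z : Fin m → ℝ => reduced B A ν (H *ᵥ z) :=
    (continuous_const.matrix_mulVec continuous_id).add continuous_const
  have hRm (A : Finset (Fin K)) : MeasurableSet (R A) :=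
    (hred A).measurable (measurableSet_inRegion B (H * H) J I A ν)
  have hGm (A : Finset (Fin K)) : MeasurableSet (G A) := by
    have hres := (continuous_activeResidual B A (H * H)).comp (hred A)
    have hT : Continuous fun z =>
        sqNorm (H * H) (activeResidual B A (H * H) (reduced B A ν (H *ᵥ z))) :=
      hres.dotProduct (continuous_const.matrix_mulVec hres)
    exact (hRm A).inter (measurableSet_lt hT.measurable measurable_const)
  have hRG (A : Finset (Fin K)) (hA : A ∈ 𝒜) :
      ENNReal.ofReal q * stdNormal m (R A) ≤ stdNormal m (G A) := by
    have hAJ := (h𝒜.1 hA).1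
    have hind := hB A (hAu A hAJ)
    rcases (Finset.card_le_card hAJ).trans hJcard |>.lt_or_eq with hc | hc
    · refine mul_stdNormal_inRegion_le hH hS hind hc hν hνJ ?_
      have hmax : max (m - A.card) 1 = m - A.card := max_eq_left (by omega)
      rw [hmax]
      exact le_chiSq_Iio_chiSqQuantile (by omega) hq
    · have hsub : R A ⊆ G A := fun z hz => ⟨hz, by
        rw [activeResidual_eq_zero hind hS hc]
        simpa [sqNorm] using chiSqQuantile_pos (le_max_right _ 1) hq⟩
      calc ENNReal.ofReal q * stdNormal m (R A) ≤ 1 * stdNormal m (R A) := by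
            gcongr
            exact ENNReal.ofReal_le_one.2 hq.2.le
        _ ≤ stdNormal m (G A) := by rw [one_mul]; exact measure_mono hsub
  have hdisj : Set.PairwiseDisjoint (𝒜 : Set (Finset (Fin K))) G := by
    intro A hA A' hA' hne
    rw [Finset.mem_coe, h𝒜] at hA hA'
    refine Set.disjoint_left.2 fun z hz hz' => hne ?_
    exact InRegion.active_unique hS (hB J hJ) hA.1 hA.2 hA'.1 hA'.2 hz.1 hz'.1
  -- A solution of the optimality conditions always exists, and outside a null set no slack vanishes
  -- off its active set.
  have hcover : stdNormal m (⋃ A ∈ 𝒜, R A) = 1 := by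
    have hnull : ∀ A : Finset (Fin K), A ⊆ J → A.card ≠ m → ∀ j ∉ A,
        ∀ᵐ z ∂(stdNormal m), (B *ᵥ ((H * H)⁻¹ *ᵥ
          activeResidual B A (H * H) (reduced B A ν (H *ᵥ z)))) j ≠ 0 := by
      intro A hAJ hc j hj
      have hc' : A.card < m := lt_of_le_of_ne ((Finset.card_le_card hAJ).trans hJcard) hc
      have hins : insert j A ≠ Finset.univ := fun h => by
        have := congrArg Finset.card h
        rw [Finset.card_insert_of_notMem hj, Finset.card_univ, Fintype.card_fin] at this
        omega
      have := stdNormal_slack_eq_zero hH hS (hB A (hAu A hAJ)) hj (hB _ hins) ν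
      rw [ae_iff]
      simpa using this
    have hae : ∀ᵐ z ∂(stdNormal m), ∀ A : Finset (Fin K), A ⊆ J → A.card ≠ m → ∀ j ∉ A,
        (B *ᵥ ((H * H)⁻¹ *ᵥ activeResidual B A (H * H) (reduced B A ν (H *ᵥ z)))) j ≠ 0 := by
      simp only [ae_all_iff]
      exact hnull
    refine prob_compl_eq_zero_iff (Finset.measurableSet_biUnion _ fun A _ => hRm A) |>.1 ?_
    refine measure_mono_null ?_ (ae_iff.1 hae)
    intro z hz hz'
    refine hz ?_
    obtain ⟨l, hl⟩ := exists_isKKT (B := B) (I := I) hH rfl hS (hB J hJ) hIJ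
      (H *ᵥ z + Bᵀ *ᵥ ν)
    obtain ⟨A, hIA, hAJ, hA⟩ := hl.exists_inRegion hS (hB J hJ) hIJ hz' fun A hA hc =>
      Finset.eq_of_subset_of_card_le hA (hc ▸ hJcard)
    exact Set.mem_biUnion (h𝒜.2 ⟨hAJ, hIA⟩) hA
  -- The union bound suffices for the covering events `R A`; disjointness is needed for the events
  -- `G A`.
  calc ENNReal.ofReal q = ENNReal.ofReal q * stdNormal m (⋃ A ∈ 𝒜, R A) := by
        rw [hcover, mul_one]
    _ ≤ ENNReal.ofReal q * ∑ A ∈ 𝒜, stdNormal m (R A) := by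
        gcongr
        exact measure_biUnion_finset_le _ _
    _ = ∑ A ∈ 𝒜, ENNReal.ofReal q * stdNormal m (R A) := Finset.mul_sum _ _ _
    _ ≤ ∑ A ∈ 𝒜, stdNormal m (G A) := Finset.sum_le_sum hRG
    _ = stdNormal m (⋃ A ∈ 𝒜, G A) := (measure_biUnion_finset hdisj fun A _ => hGm A).symm
    _ ≤ _ := by
        refine measure_mono fun z hz => ?_
        obtain ⟨A, hA, hz⟩ := Set.mem_iUnion₂.1 hz
        exact ⟨A, (h𝒜.1 hA).2, (h𝒜.1 hA).1, hz⟩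

end Whitening

/-! ### Matrix norms, eigenvalues and square roots. -/

section Matrices

variable {m : ℕ}

theorem frobNorm_sq (D : Matrix (Fin m) (Fin m) ℝ) : frobNorm D ^ 2 = ∑ i, ∑ j, D i j ^ 2 := by
  have h : (Dᵀ * D).trace = ∑ i, ∑ j, D i j ^ 2 := by
    rw [Finset.sum_comm]
    simp [Matrix.trace, Matrix.mul_apply, sq]
  rw [frobNorm, h, Real.sq_sqrt (by positivity)]

theorem abs_le_frobNorm (D : Matrix (Fin m) (Fin m) ℝ) (i j : Fin m) : |D i j| ≤ frobNorm D := by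
  refine abs_le_of_sq_le_sq ?_ (Real.sqrt_nonneg _)
  rw [frobNorm_sq]
  calc D i j ^ 2 ≤ ∑ j', D i j' ^ 2 :=
        Finset.single_le_sum (f := fun j' => D i j' ^ 2) (fun _ _ => sq_nonneg _)
          (Finset.mem_univ j)
    _ ≤ _ := Finset.single_le_sum (f := fun i' => ∑ j', D i' j' ^ 2)
        (fun _ _ => Finset.sum_nonneg fun _ _ => sq_nonneg _) (Finset.mem_univ i)

theorem exists_frobNorm_le_imp_mem {t : Set (Matrix (Fin m) (Fin m) ℝ)} (ht : t ∈ 𝓝 0) :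
    ∃ ε : ℝ, 0 < ε ∧ ∀ D, frobNorm D ≤ ε → D ∈ t := by
  obtain ⟨ε, hε, h⟩ := (Metric.mem_nhds_iff (α := Fin m → Fin m → ℝ)).1 ht
  refine ⟨ε / 2, by positivity, fun D hD => h ?_⟩
  refine (dist_pi_lt_iff hε).2 fun i => (dist_pi_lt_iff hε).2 fun j => ?_
  have := abs_le_frobNorm D i j
  rw [Real.dist_eq]
  change |D i j - (0 : ℝ)| < ε
  rw [sub_zero]
  linarith

theorem abs_dotProduct_mulVec_le (D : Matrix (Fin m) (Fin m) ℝ) {ε : ℝ}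
    (hD : ∀ i j, |D i j| ≤ ε) (x : Fin m → ℝ) : |x ⬝ᵥ (D *ᵥ x)| ≤ ε * m * (x ⬝ᵥ x) := by
  have h1 : x ⬝ᵥ (D *ᵥ x) = ∑ i, ∑ j, x i * (D i j * x j) := by
    simp only [dotProduct, Matrix.mulVec, Finset.mul_sum]
  have h2 : ∑ i : Fin m, ∑ j : Fin m, ε * ((x i ^ 2 + x j ^ 2) / 2) = ε * m * (x ⬝ᵥ x) := by
    simp only [← Finset.mul_sum, ← Finset.sum_div, Finset.sum_add_distrib, Finset.sum_const,
      Finset.card_univ, Fintype.card_fin, nsmul_eq_mul, dotProduct, ← sq]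
    ring
  rw [h1, ← h2]
  refine (Finset.abs_sum_le_sum_abs _ _).trans (Finset.sum_le_sum fun i _ =>
    (Finset.abs_sum_le_sum_abs _ _).trans (Finset.sum_le_sum fun j _ => ?_))
  rw [abs_mul, abs_mul]
  have hε : 0 ≤ ε := (abs_nonneg _).trans (hD i j)
  have h3 : |x i| * |x j| ≤ (x i ^ 2 + x j ^ 2) / 2 := by
    nlinarith [sq_nonneg (|x i| - |x j|), sq_abs (x i), sq_abs (x j)]
  calc |x i| * (|D i j| * |x j|) = |D i j| * (|x i| * |x j|) := by ring
    _ ≤ ε * ((x i ^ 2 + x j ^ 2) / 2) := mul_le_mul (hD i j) h3 (by positivity) hε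

theorem posDef_of_le_dotProduct {S : Matrix (Fin m) (Fin m) ℝ} (hS : S.IsSymm) {δ : ℝ}
    (hδ : 0 < δ) (h : ∀ x : Fin m → ℝ, δ * (x ⬝ᵥ x) ≤ x ⬝ᵥ (S *ᵥ x)) : S.PosDef := by
  refine Matrix.PosDef.of_dotProduct_mulVec_pos (by simpa [Matrix.IsHermitian] using hS.eq)
    fun x hx => ?_
  have : 0 < x ⬝ᵥ x := (Finset.sum_nonneg fun i _ => mul_self_nonneg (x i)).lt_of_ne' fun h =>
    hx (dotProduct_self_eq_zero.1 h)
  simpa using (mul_pos hδ this).trans_le (h x)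

/-- Subtracting `δ` shifts the spectrum by `δ`, so `S - δ` has nonnegative eigenvalues. -/
theorem le_dotProduct_of_lt_minEigenvalue {S : Matrix (Fin m) (Fin m) ℝ} (hS : S.IsHermitian)
    {δ : ℝ} (h : (δ : EReal) < minEigenvalue S) (x : Fin m → ℝ) :
    δ * (x ⬝ᵥ x) ≤ x ⬝ᵥ (S *ᵥ x) := by
  have hD : (-algebraMap ℝ (Matrix (Fin m) (Fin m) ℝ) δ + S).IsHermitian := by
    refine Matrix.IsHermitian.add (Matrix.IsHermitian.neg ?_) hS
    rw [Algebra.algebraMap_eq_smul_one]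
    simp [Matrix.IsHermitian]
  have hpsd : (-algebraMap ℝ (Matrix (Fin m) (Fin m) ℝ) δ + S).PosSemidef := by
    rw [hD.posSemidef_iff_eigenvalues_nonneg]
    intro i
    have h1 := spectrum.add_mem_iff.2 (hD.eigenvalues_mem_spectrum_real i)
    have h2 : minEigenvalue S ≤ ((hD.eigenvalues i + δ : ℝ) : EReal) := iInf₂_le _ h1
    have h3 := h.trans_le h2
    rw [EReal.coe_lt_coe_iff] at h3
    change 0 ≤ hD.eigenvalues i
    linarith
  have h4 := hpsd.dotProduct_mulVec_nonneg x
  rw [Algebra.algebraMap_eq_smul_one, Matrix.add_mulVec, dotProduct_add, Matrix.neg_mulVec,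
    Matrix.smul_mulVec, Matrix.one_mulVec] at h4
  simp only [star_trivial, dotProduct_neg, dotProduct_smul, smul_eq_mul] at h4
  linarith

open scoped MatrixOrder in
theorem sqrt_mul_sqrt {S : Matrix (Fin m) (Fin m) ℝ} (hS : S.PosDef) :
    CFC.sqrt S * CFC.sqrt S = S :=
  CFC.sqrt_mul_sqrt_self S hS.posSemidef.nonneg

open scoped MatrixOrder in
theorem transpose_sqrt (S : Matrix (Fin m) (Fin m) ℝ) : (CFC.sqrt S)ᵀ = CFC.sqrt S := by
  have := (Matrix.nonneg_iff_posSemidef.1 (CFC.sqrt_nonneg S)).isHermitian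
  simpa [Matrix.IsHermitian] using this

/-- A sequence of symmetric matrices with bounded squares converges along an ultrafilter. -/
theorem exists_tendsto_of_mul_self_bounded {ι : Type*} (𝒰 : Ultrafilter ι)
    {H : ι → Matrix (Fin m) (Fin m) ℝ} (hsymm : ∀ᶠ n in 𝒰, (H n)ᵀ = H n) {C : ℝ}
    (hC : ∀ᶠ n in 𝒰, frobNorm (H n * H n) ≤ C) : ∃ H₀, Tendsto H 𝒰 (𝓝 H₀) := by
  have hmem : ∀ᶠ n in 𝒰, H n ∈ (Set.univ.pi fun _ => Set.univ.pi fun _ =>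
      Set.Icc (-(1 + C)) (1 + C) : Set (Fin m → Fin m → ℝ)) := by
    filter_upwards [hsymm, hC] with n h1 h2 i _ j _
    -- By symmetry, the diagonal entries of `H * H` are the row sums of squares of `H`.
    have h3 : H n i j ^ 2 ≤ C := by
      calc H n i j ^ 2 ≤ ∑ k, H n i k ^ 2 :=
            Finset.single_le_sum (f := fun k => H n i k ^ 2) (fun _ _ => sq_nonneg _)
              (Finset.mem_univ j)
        _ = (H n * H n) i i := by
            rw [Matrix.mul_apply]
            refine Finset.sum_congr rfl fun k _ => ?_
            nth_rewrite 3 [← h1]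
            rw [Matrix.transpose_apply, sq]
        _ ≤ |(H n * H n) i i| := le_abs_self _
        _ ≤ C := (abs_le_frobNorm _ i i).trans h2
    constructor <;> nlinarith [sq_nonneg (H n i j - 1), sq_nonneg (H n i j + 1)]
  have hcomp : IsCompact (Set.univ.pi fun _ => Set.univ.pi fun _ =>
      Set.Icc (-(1 + C)) (1 + C) : Set (Fin m → Fin m → ℝ)) :=
    isCompact_univ_pi fun _ => isCompact_univ_pi fun _ => isCompact_Icc
  obtain ⟨H₀, -, h⟩ := hcomp.ultrafilter_le_nhds (𝒰.map H) (le_principal_iff.2 hmem)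
  exact ⟨H₀, h⟩

end Matrices

/-! ### First-order conditions on the simplex, and limits of multipliers. -/

section Multipliers

variable {K : ℕ}

/-- The multipliers of the constraints at a minimiser over the simplex. -/
noncomputable def lagrange (Q : (Fin K → ℝ) → ℝ) (w : Fin K → ℝ) : Fin K → ℝ :=
  grad Q w - fun _ => w ⬝ᵥ grad Q w

/-- The derivative at a minimiser towards each vertex of the simplex is nonnegative, which bounds
each partial derivative below by the average `w ⬝ᵥ grad Q w`. Orthogonality to `w` holds because the
weights sum to one. -/
theorem lagrange_mem_multipliers {Q : (Fin K → ℝ) → ℝ} (hQ : Differentiable ℝ Q)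
    {w : Fin K → ℝ} (hw : w ∈ argminSet Q) : lagrange Q w ∈ multipliers w := by
  have hlin (v : Fin K → ℝ) : fderiv ℝ Q w v = v ⬝ᵥ grad Q w := by
    conv_lhs => rw [← Finset.univ_sum_single v]
    rw [map_sum]
    refine Finset.sum_congr rfl fun j _ => ?_
    have : (Pi.single j (v j) : Fin K → ℝ) = v j • Pi.single j 1 := by
      rw [← Pi.single_smul, smul_eq_mul, mul_one]
    rw [this, map_smul, smul_eq_mul, grad]
  constructor
  · rw [lagrange, dotProduct_sub]
    have : w ⬝ᵥ (fun _ => w ⬝ᵥ grad Q w) = (∑ j, w j) * (w ⬝ᵥ grad Q w) := by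
      rw [Finset.sum_mul]; rfl
    rw [this, hw.1.2, one_mul, sub_self]
  · intro j
    have hseg : segment ℝ w (Pi.single j 1) ⊆ stdSimplex ℝ (Fin K) :=
      (convex_stdSimplex ℝ (Fin K)).segment_subset hw.1 (single_mem_stdSimplex ℝ j)
    have h := hw.2.localize.hasFDerivWithinAt_nonneg (hQ w).hasFDerivAt.hasFDerivWithinAt
      (sub_mem_posTangentConeAt_of_segment_subset hseg)
    rw [hlin, sub_dotProduct, single_dotProduct, one_mul] at h
    simpa [lagrange] using h

/-- The multipliers differ from the gradient by a constant vector, which `B₂'` annihilates. So the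
population mean `f_P` lies in the cone generated by the rows. -/
theorem IsComplement.mulVec_lagrange {B₂ : Matrix (Fin K) (Fin (K - 1)) ℝ}
    (hB : IsComplement B₂) (Q : (Fin K → ℝ) → ℝ) (w : Fin K → ℝ) :
    B₂ᵀ *ᵥ lagrange Q w = B₂ᵀ *ᵥ grad Q w := by
  have : (fun _ => w ⬝ᵥ grad Q w : Fin K → ℝ) = (w ⬝ᵥ grad Q w) • fun _ => (1 : ℝ) := by
    ext; simp
  rw [lagrange, Matrix.mulVec_sub, this, Matrix.mulVec_smul, hB.2, smul_zero, sub_zero]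

theorem argminSet_nonempty {Q : (Fin K → ℝ) → ℝ} (hQ : Continuous Q)
    (hne : (stdSimplex ℝ (Fin K)).Nonempty) : (argminSet Q).Nonempty := by
  obtain ⟨w, hw, h⟩ := (isCompact_stdSimplex ℝ (Fin K)).exists_isMinOn hne hQ.continuousOn
  exact ⟨w, hw, h⟩

/-- A nonnegative sequence converges along an ultrafilter to a finite limit or to infinity. -/
theorem exists_tendsto_or_tendsto_atTop {ι : Type*} (𝒰 : Ultrafilter ι) {a : ι → ℝ}
    (ha : ∀ᶠ n in 𝒰, 0 ≤ a n) :
    (∃ b, 0 ≤ b ∧ Tendsto a 𝒰 (𝓝 b)) ∨ Tendsto a 𝒰 atTop := by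
  by_cases h : ∃ C, ∀ᶠ n in 𝒰, a n ≤ C
  · obtain ⟨C, hC⟩ := h
    obtain ⟨b, hb, h⟩ := (isCompact_Icc (a := (0 : ℝ)) (b := C)).ultrafilter_le_nhds (𝒰.map a)
      (le_principal_iff.2 (ha.and hC))
    exact Or.inl ⟨b, hb.1, h⟩
  · push Not at h
    refine Or.inr (tendsto_atTop.2 fun C => ?_)
    filter_upwards [h C] with n hn using hn.le

end Multipliers

/-! ### Stability of the good event under perturbation. -/

section Asymptotics

/-- If an event that depends on `(Z n, D n)` holds eventually near every point of a set `G`, where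
`Z n` converges in law to `γ` and `D n` to zero in probability, then its probability is
asymptotically at least `γ G`. -/
theorem eventually_lt_measure_of_eventually_nhds {m : ℕ} {X : ℕ → Type*}
    [∀ n, MeasurableSpace (X n)] {P : ∀ n, Measure (X n)} {l : Filter ℕ}
    {γ : Measure (Fin m → ℝ)} [IsFiniteMeasure γ] {Z : ∀ n, X n → Fin m → ℝ}
    {D : ∀ n, X n → Matrix (Fin m) (Fin m) ℝ}
    (hZ : ∀ U : Set (Fin m → ℝ), IsOpen U → ∀ r < γ U, ∀ᶠ n in l, r < P n {x | Z n x ∈ U})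
    (hD : ∀ ε : ℝ, 0 < ε → Tendsto (fun n => P n {x | ε < frobNorm (D n x)}) l (𝓝 0))
    {good : ℕ → (Fin m → ℝ) → Matrix (Fin m) (Fin m) ℝ → Prop} {G : Set (Fin m → ℝ)}
    (hG : ∀ z ∈ G, ∀ᶠ p : (Fin m → ℝ) × (ℕ × Matrix (Fin m) (Fin m) ℝ) in 𝓝 z ×ˢ (l ×ˢ 𝓝 0),
      good p.2.1 p.1 p.2.2)
    {r : ℝ≥0∞} (hr : r < γ G) : ∀ᶠ n in l, r < P n {x | good n (Z n x) (D n x)} := by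
  set s : Set ((Fin m → ℝ) × (ℕ × Matrix (Fin m) (Fin m) ℝ)) := {p | good p.2.1 p.1 p.2.2}
  set G' : Set (Fin m → ℝ) := {z | s ∈ 𝓝 z ×ˢ (l ×ˢ 𝓝 (0 : Matrix (Fin m) (Fin m) ℝ))}
  have hG'open : IsOpen G' := by
    refine isOpen_iff_mem_nhds.2 fun z hz => ?_
    obtain ⟨u, hu, t, ht, hut⟩ := mem_prod_iff.1 hz
    filter_upwards [eventually_mem_nhds_iff.2 hu] with z' hz'
    exact mem_prod_iff.2 ⟨u, hz', t, ht, hut⟩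
  -- Inner regularity gives a compact set of sufficient mass, over which the pointwise
  -- neighbourhoods can be made uniform.
  obtain ⟨C, hCG, hC, hrC⟩ := hG'open.exists_lt_isCompact (hr.trans_le (measure_mono hG))
  obtain ⟨u, hu, t, ht, hut⟩ := mem_prod_iff.1 (hC.mem_nhdsSet_prod_of_forall hCG)
  obtain ⟨t₁, ht₁, t₂, ht₂, htt⟩ := mem_prod_iff.1 ht
  obtain ⟨U, hU, hCU, hUu⟩ := mem_nhdsSet_iff_exists.1 hu
  obtain ⟨ε, hε, hball⟩ := exists_frobNorm_le_imp_mem ht₂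
  -- The gap `r₁ - r` absorbs the probability that `D n` is not small.
  obtain ⟨r₁, hr₁, hr₁U⟩ := exists_between (hrC.trans_le (measure_mono hCU))
  have hsmall := (hD ε hε).eventually (gt_mem_nhds (tsub_pos_of_lt hr₁))
  filter_upwards [hZ U hU r₁ hr₁U, hsmall, ht₁] with n h1 h2 h3
  have hsub : {x | Z n x ∈ U} ⊆ {x | good n (Z n x) (D n x)} ∪ {x | ε < frobNorm (D n x)} := by
    intro x hx
    by_cases hx' : ε < frobNorm (D n x)
    · exact Or.inr hx'
    · exact Or.inl (hut (Set.mk_mem_prod (hUu hx)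
        (htt (Set.mk_mem_prod h3 (hball _ (not_lt.1 hx'))))))
  by_contra hcon
  have h4 : r₁ < r₁ := calc
    r₁ < P n {x | Z n x ∈ U} := h1
    _ ≤ P n {x | good n (Z n x) (D n x)} + P n {x | ε < frobNorm (D n x)} :=
      (measure_mono hsub).trans (measure_union_le _ _)
    _ ≤ r + (r₁ - r) := add_le_add (not_lt.1 hcon) h2.le
    _ = r₁ := add_tsub_cancel_of_le hr₁.le
  exact lt_irrefl _ h4

variable {K m : ℕ} {B : Matrix (Fin K) (Fin m) ℝ} {J I A : Finset (Fin K)}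

/-- The limiting active set with strict complementarity is the active set at nearby points, with
multipliers that tend to infinity in `I`. -/
theorem eventually_inRegion {l : Filter ℕ} {H : ℕ → Matrix (Fin m) (Fin m) ℝ}
    {H₀ : Matrix (Fin m) (Fin m) ℝ} (hH : Tendsto H l (𝓝 H₀)) (hS : (H₀ * H₀).PosDef)
    (hA : RowsIndependent B A) (hIA : I ⊆ A) {ν : ℕ → Fin K → ℝ} {ν₀ : Fin K → ℝ}
    (hν : ∀ j ∉ I, Tendsto (fun n => ν n j) l (𝓝 (ν₀ j)))
    (hνI : ∀ j ∈ I, Tendsto (fun n => ν n j) l atTop) {z : Fin m → ℝ}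
    (hreg : InRegion B (H₀ * H₀) J I A ν₀ (reduced B A ν₀ (H₀ *ᵥ z))) {c : ℝ}
    (hc : sqNorm (H₀ * H₀) (activeResidual B A (H₀ * H₀) (reduced B A ν₀ (H₀ *ᵥ z))) < c) :
    ∀ᶠ p : (Fin m → ℝ) × (ℕ × Matrix (Fin m) (Fin m) ℝ) in 𝓝 z ×ˢ (l ×ˢ 𝓝 0),
      InRegion B (H p.2.1 * H p.2.1 + p.2.2) J ∅ A (ν p.2.1)
        (reduced B A (ν p.2.1) (H p.2.1 *ᵥ p.1)) ∧
      sqNorm (H p.2.1 * H p.2.1 + p.2.2) (activeResidual B A (H p.2.1 * H p.2.1 + p.2.2)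
        (reduced B A (ν p.2.1) (H p.2.1 *ᵥ p.1))) ≤ c := by
  set L : Filter ((Fin m → ℝ) × (ℕ × Matrix (Fin m) (Fin m) ℝ)) := 𝓝 z ×ˢ (l ×ˢ 𝓝 0)
  have hz : Tendsto (fun p : (Fin m → ℝ) × (ℕ × Matrix (Fin m) (Fin m) ℝ) => p.1) L (𝓝 z) :=
    tendsto_fst
  have hn : Tendsto (fun p : (Fin m → ℝ) × (ℕ × Matrix (Fin m) (Fin m) ℝ) => p.2.1) L l :=
    tendsto_fst.comp tendsto_snd
  have hDt : Tendsto (fun p : (Fin m → ℝ) × (ℕ × Matrix (Fin m) (Fin m) ℝ) => p.2.2) L (𝓝 0) :=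
    tendsto_snd.comp tendsto_snd
  have hHn := hH.comp hn
  have hSt : Tendsto (fun p : (Fin m → ℝ) × (ℕ × Matrix (Fin m) (Fin m) ℝ) =>
      H p.2.1 * H p.2.1 + p.2.2) L (𝓝 (H₀ * H₀)) := by
    have hmul : Continuous fun q : Matrix (Fin m) (Fin m) ℝ => q * q :=
      continuous_id.matrix_mul continuous_id
    simpa using ((hmul.tendsto H₀).comp hHn).add hDt
  have hxt : Tendsto (fun p : (Fin m → ℝ) × (ℕ × Matrix (Fin m) (Fin m) ℝ) =>
      reduced B A (ν p.2.1) (H p.2.1 *ᵥ p.1)) L (𝓝 (reduced B A ν₀ (H₀ *ᵥ z))) := by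
    have hmv : Continuous fun q : Matrix (Fin m) (Fin m) ℝ × (Fin m → ℝ) => q.1 *ᵥ q.2 :=
      continuous_fst.matrix_mulVec continuous_snd
    have hBm : Continuous fun v : Fin K → ℝ => Bᵀ *ᵥ v :=
      continuous_const.matrix_mulVec continuous_id
    refine ((hmv.tendsto (H₀, z)).comp (hHn.prodMk_nhds hz)).add ((hBm.tendsto _).comp ?_)
    -- The reduced data involve `ν` only outside `A`, and `I ⊆ A` ensures that all limits there are
    -- finite.
    refine tendsto_pi_nhds.2 fun j => ?_
    by_cases hj : j ∈ A
    · simpa [hj] using tendsto_const_nhds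
    · simpa [hj, Function.comp_def] using (hν j fun h => hj (hIA h)).comp hn
  have hq := hSt.prodMk_nhds hxt
  have hmult (j : Fin K) := ((continuous_apply j).tendsto _).comp
    ((continuousAt_activeMultiplier hA hS (reduced B A ν₀ (H₀ *ᵥ z))).tendsto.comp hq)
  have hslack (j : Fin K) := (continuousAt_slack hA hS (reduced B A ν₀ (H₀ *ᵥ z)) j).tendsto.comp hq
  have hT := (continuousAt_sqNorm_activeResidual hA hS
    (reduced B A ν₀ (H₀ *ᵥ z))).tendsto.comp hq
  have e1 : ∀ᶠ p in L, ∀ j, j ∈ A → 0 < activeMultiplier B A (H p.2.1 * H p.2.1 + p.2.2)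
      (reduced B A (ν p.2.1) (H p.2.1 *ᵥ p.1)) j + ν p.2.1 j := by
    refine eventually_all.2 fun j => ?_
    by_cases hj : j ∈ A
    · by_cases hjI : j ∈ I
      -- For `j ∈ I` the multiplier computed from the reduced data converges while `ν j` diverges,
      -- so the sign constraint, absent in the limit, holds eventually.
      · filter_upwards [((hmult j).add_atTop ((hνI j hjI).comp hn)).eventually_gt_atTop 0]
          with p hp _ using hp
      · filter_upwards [((hmult j).add ((hν j hjI).comp hn)).eventually
          (lt_mem_nhds (hreg.multiplier_pos j hj hjI))] with p hp _ using hp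
    · exact Eventually.of_forall fun p h => absurd h hj
  have e2 : ∀ᶠ p in L, ∀ j, j ∈ J → j ∉ A → (B *ᵥ ((H p.2.1 * H p.2.1 + p.2.2)⁻¹ *ᵥ
      activeResidual B A (H p.2.1 * H p.2.1 + p.2.2)
        (reduced B A (ν p.2.1) (H p.2.1 *ᵥ p.1)))) j < 0 := by
    refine eventually_all.2 fun j => ?_
    by_cases hj : j ∈ J ∧ j ∉ A
    · filter_upwards [(hslack j).eventually (gt_mem_nhds (hreg.slack_neg j hj.1 hj.2))]
        with p hp _ _ using hp
    · exact Eventually.of_forall fun p h h' => absurd ⟨h, h'⟩ hj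
  have e3 : ∀ᶠ p in L, ∀ j, A.card ≠ m → j ∉ J → (B *ᵥ ((H p.2.1 * H p.2.1 + p.2.2)⁻¹ *ᵥ
      activeResidual B A (H p.2.1 * H p.2.1 + p.2.2)
        (reduced B A (ν p.2.1) (H p.2.1 *ᵥ p.1)))) j ≠ 0 := by
    refine eventually_all.2 fun j => ?_
    by_cases hj : A.card ≠ m ∧ j ∉ J
    · filter_upwards [(hslack j).eventually_ne (hreg.slack_ne hj.1 j hj.2)] with p hp _ _ using hp
    · exact Eventually.of_forall fun p h h' => absurd ⟨h, h'⟩ hj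
  filter_upwards [e1, e2, e3, hT.eventually (gt_mem_nhds hc)] with p h1 h2 h3 h4
  exact ⟨⟨fun j hj _ => h1 j hj, h2, fun h j hj => h3 j h hj⟩, h4.le⟩

/-- Symmetric perturbations of uniformly positive definite matrices are positive definite. -/
theorem eventually_posDef_add {l : Filter ℕ} {S : ℕ → Matrix (Fin m) (Fin m) ℝ} {δ : ℝ}
    (hδ : 0 < δ) (hS : ∀ᶠ n in l, ∀ x : Fin m → ℝ, δ * (x ⬝ᵥ x) ≤ x ⬝ᵥ (S n *ᵥ x))
    (z : Fin m → ℝ) :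
    ∀ᶠ p : (Fin m → ℝ) × (ℕ × Matrix (Fin m) (Fin m) ℝ) in 𝓝 z ×ˢ (l ×ˢ 𝓝 0),
      (S p.2.1 + p.2.2).IsSymm → (S p.2.1 + p.2.2).PosDef := by
  -- Entries bounded by `ε` change the quadratic form by at most `ε m ≤ δ / 2`; `m + 1` avoids
  -- division by zero.
  set ε : ℝ := δ / (2 * (m + 1)) with hε
  have hεpos : 0 < ε := by positivity
  have hD : ∀ᶠ D : Matrix (Fin m) (Fin m) ℝ in 𝓝 0, ∀ i j, |D i j| ≤ ε := by
    refine eventually_all.2 fun i => eventually_all.2 fun j => ?_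
    have hc : Continuous fun D : Matrix (Fin m) (Fin m) ℝ => |D i j| :=
      (continuous_id.matrix_elem i j).abs
    have := hc.tendsto 0
    simp only [Matrix.zero_apply, abs_zero] at this
    filter_upwards [this.eventually (gt_mem_nhds hεpos)] with D h using h.le
  filter_upwards [(hS.prod_mk hD).prod_inr (𝓝 z)] with p hp hsymm
  refine posDef_of_le_dotProduct hsymm (half_pos hδ) fun x => ?_
  have h1 := hp.1 x
  have h2 := (abs_le.1 (abs_dotProduct_mulVec_le p.2.2 hp.2 x)).1
  have h3 : ε * m ≤ δ / 2 := by
    rw [hε, div_mul_eq_mul_div, div_le_div_iff₀ (by positivity) (by positivity)]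
    nlinarith
  have h4 : 0 ≤ x ⬝ᵥ x := Finset.sum_nonneg fun i _ => mul_self_nonneg (x i)
  rw [Matrix.add_mulVec, dotProduct_add]
  nlinarith [mul_le_mul_of_nonneg_right h3 h4]

end Asymptotics

/-! ### Asymptotic coverage along a sequence. -/

section Coverage

variable {m : ℕ} {X : ℕ → Type*} [∀ n, MeasurableSpace (X n)]

/-- Convergence of distribution functions bounds the limiting probability of open sets. -/
theorem eventually_lt_measure_isOpen {P : ∀ n, Measure (X n)}
    (hP : ∀ n, 1 ≤ n → IsProbabilityMeasure (P n)) {Z : ∀ n, X n → Fin m → ℝ}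
    (hZ : ∀ n, 1 ≤ n → Measurable (Z n))
    (h : ∀ t, Tendsto (fun n => P n {x | Z n x ≤ t}) atTop (𝓝 (stdNormal m (Set.Iic t))))
    {U : Set (Fin m → ℝ)} (hU : IsOpen U) {r : ℝ≥0∞} (hr : r < stdNormal m U) :
    ∀ᶠ n in atTop, r < P n {x | Z n x ∈ U} := by
  have hprob (k : ℕ) : IsProbabilityMeasure ((P (k + 1)).map (Z (k + 1))) := by
    have := hP (k + 1) (Nat.le_add_left 1 k)
    exact Measure.isProbabilityMeasure_map (hZ (k + 1) (Nat.le_add_left 1 k)).aemeasurable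
  -- The index is shifted by one because nothing is assumed at sample size zero.
  let μ : ℕ → ProbabilityMeasure (Fin m → ℝ) := fun k => ⟨(P (k + 1)).map (Z (k + 1)), hprob k⟩
  let γ : ProbabilityMeasure (Fin m → ℝ) := ⟨stdNormal m, inferInstance⟩
  have hμ (k : ℕ) {s : Set (Fin m → ℝ)} (hs : MeasurableSet s) :
      (μ k : Measure (Fin m → ℝ)) s = P (k + 1) {x | Z (k + 1) x ∈ s} :=
    Measure.map_apply (hZ (k + 1) (Nat.le_add_left 1 k)) hs
  have hlim : Tendsto μ atTop (𝓝 γ) := by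
    refine tendsto_probabilityMeasure_of_tendsto_Iic fun t => ?_
    simp only [hμ _ measurableSet_Iic]
    exact (tendsto_add_atTop_iff_nat 1).2 (h t)
  have hle := ProbabilityMeasure.le_liminf_measure_open_of_tendsto hlim hU
  have hev := eventually_lt_of_lt_liminf (hr.trans_le hle)
  simp only [hμ _ hU.measurableSet] at hev
  rw [← map_add_atTop_eq_nat 1]
  exact hev

/-- Along an ultrafilter, the set of zero weights is constant and every scaled multiplier converges
to a finite limit or to infinity. -/
theorem exists_limit_multipliers {K : ℕ} (𝒰 : Ultrafilter ℕ) {w ν : ℕ → Fin K → ℝ}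
    (hw : ∀ᶠ n in 𝒰, w n ∈ stdSimplex ℝ (Fin K)) (hν : ∀ᶠ n in 𝒰, ν n ∈ multipliers (w n)) :
    ∃ (J I : Finset (Fin K)) (ν₀ : Fin K → ℝ), (∀ᶠ n in 𝒰, ∀ j, j ∈ J ↔ w n j = 0) ∧
      J ≠ Finset.univ ∧ I ⊆ J ∧ (∀ j, 0 ≤ ν₀ j) ∧ (∀ j ∉ J, ν₀ j = 0) ∧
      (∀ j ∉ I, Tendsto (fun n => ν n j) 𝒰 (𝓝 (ν₀ j))) ∧
      ∀ j ∈ I, Tendsto (fun n => ν n j) 𝒰 atTop := by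
  classical
  obtain ⟨J, hJ⟩ : ∃ J : Finset (Fin K), ∀ᶠ n in 𝒰, ∀ j, j ∈ J ↔ w n j = 0 := by
    obtain ⟨J, hJ⟩ := (𝒰.map fun n => Finset.univ.filter fun j => w n j = 0).eq_pure_of_finite
    refine ⟨J, ?_⟩
    have : {J} ∈ (𝒰.map fun n => Finset.univ.filter fun j => w n j = 0) := by
      rw [hJ]; exact rfl
    filter_upwards [this] with n hn j
    rw [← Set.mem_singleton_iff.1 hn]
    simp
  have hJu : J ≠ Finset.univ := by
    rintro rfl
    obtain ⟨n, hn, h⟩ := (hw.and hJ).exists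
    have h0 : ∑ j, w n j = 0 := Finset.sum_eq_zero fun j _ => (h j).1 (Finset.mem_univ j)
    rw [hn.2] at h0
    exact one_ne_zero h0
  have hνout (j : Fin K) (hj : j ∉ J) : ∀ᶠ n in 𝒰, ν n j = 0 := by
    filter_upwards [hw, hν, hJ] with n hn hνn h
    have h0 : ∀ i ∈ Finset.univ, 0 ≤ w n i * ν n i :=
      fun i _ => mul_nonneg (hn.1 i) (hνn.2 i)
    have h1 := (Finset.sum_eq_zero_iff_of_nonneg h0).1 hνn.1 j (Finset.mem_univ j)
    exact (mul_eq_zero.1 h1).resolve_left fun h' => hj ((h j).2 h')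
  have hlim (j : Fin K) := exists_tendsto_or_tendsto_atTop 𝒰 (hν.mono fun n hn => hn.2 j)
  set I : Finset (Fin K) := Finset.univ.filter fun j => Tendsto (fun n => ν n j) 𝒰 atTop
  have hνI (j : Fin K) (hj : j ∈ I) : Tendsto (fun n => ν n j) 𝒰 atTop :=
    (Finset.mem_filter.1 hj).2
  have hIJ : I ⊆ J := fun j hj => by
    by_contra hjJ
    obtain ⟨n, h1, h2⟩ := ((hνout j hjJ).and ((hνI j hj).eventually_gt_atTop 0)).exists
    exact h2.ne' h1
  have hfin (j : Fin K) : ∃ b, 0 ≤ b ∧ (j ∉ I → Tendsto (fun n => ν n j) 𝒰 (𝓝 b)) ∧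
      (j ∉ J → b = 0) := by
    by_cases hj : j ∈ I
    · exact ⟨0, le_rfl, fun h => absurd hj h, fun _ => rfl⟩
    · obtain ⟨b, hb, h⟩ := (hlim j).resolve_right fun h =>
        hj (Finset.mem_filter.2 ⟨Finset.mem_univ j, h⟩)
      refine ⟨b, hb, fun _ => h, fun hjJ => tendsto_nhds_unique h ?_⟩
      exact tendsto_const_nhds.congr' ((hνout j hjJ).mono fun n hn => hn.symm)
  choose ν₀ hν₀nn hν₀ hν₀J using hfin
  exact ⟨J, I, ν₀, hJ, hJu, hIJ, hν₀nn, hν₀J, hν₀, hνI⟩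

/-- Square roots of bounded, uniformly positive definite matrices have a limit along an
ultrafilter whose square is positive definite. -/
theorem exists_limit_sqrt (𝒰 : Ultrafilter ℕ) {H : ℕ → Matrix (Fin m) (Fin m) ℝ}
    (hsymm : ∀ n, (H n)ᵀ = H n) {C δ : ℝ} (hδ : 0 < δ)
    (hC : ∀ᶠ n in 𝒰, frobNorm (H n * H n) ^ 2 ≤ C)
    (hδH : ∀ᶠ n in 𝒰, ∀ x : Fin m → ℝ, δ * (x ⬝ᵥ x) ≤ x ⬝ᵥ ((H n * H n) *ᵥ x)) :
    ∃ H₀, Tendsto H 𝒰 (𝓝 H₀) ∧ H₀ᵀ = H₀ ∧ (H₀ * H₀).PosDef := by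
  obtain ⟨H₀, hH₀⟩ : ∃ H₀, Tendsto H 𝒰 (𝓝 H₀) := by
    refine exists_tendsto_of_mul_self_bounded 𝒰 (Eventually.of_forall hsymm) (C := 1 + C) ?_
    filter_upwards [hC] with n h
    nlinarith [sq_nonneg (frobNorm (H n * H n) - 1), sq_nonneg (frobNorm (H n * H n))]
  have hH₀symm : H₀ᵀ = H₀ := by
    refine tendsto_nhds_unique (f := H) (l := (𝒰 : Filter ℕ)) ?_ hH₀
    have hc : Continuous fun M : Matrix (Fin m) (Fin m) ℝ => Mᵀ := continuous_id.matrix_transpose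
    exact ((hc.tendsto H₀).comp hH₀).congr hsymm
  refine ⟨H₀, hH₀, hH₀symm, ?_⟩
  refine posDef_of_le_dotProduct (by rw [Matrix.IsSymm, Matrix.transpose_mul, hH₀symm]) hδ
    fun x => ?_
  have hc : Continuous fun M : Matrix (Fin m) (Fin m) ℝ => x ⬝ᵥ ((M * M) *ᵥ x) :=
    continuous_const.dotProduct ((continuous_id.matrix_mul continuous_id).matrix_mulVec
      continuous_const)
  exact ge_of_tendsto ((hc.tendsto H₀).comp hH₀) (hδH.mono fun n h => h x)

variable {K : ℕ} {B₂ : Matrix (Fin K) (Fin (K - 1)) ℝ}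

/-- Asymptotic coverage in terms of standardised estimators `Z n` of the gradient and estimation
errors `D n` of the variance matrix. -/
theorem eventually_lt_coverage_of_standardised (hB : IsComplement B₂) {α : ℝ}
    (hα : α ∈ Set.Ioo (0 : ℝ) 1) {P : ∀ n, Measure (X n)} (𝒰 : Ultrafilter ℕ)
    (hn1 : ∀ᶠ n in 𝒰, 1 ≤ n) {w ν : ℕ → Fin K → ℝ}
    (hw : ∀ᶠ n in 𝒰, w n ∈ stdSimplex ℝ (Fin K)) (hν : ∀ᶠ n in 𝒰, ν n ∈ multipliers (w n))
    {H : ℕ → Matrix (Fin (K - 1)) (Fin (K - 1)) ℝ}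
    (hsymm : ∀ n, (H n)ᵀ = H n) {C δ : ℝ} (hδ : 0 < δ)
    (hC : ∀ᶠ n in 𝒰, frobNorm (H n * H n) ^ 2 ≤ C)
    (hδH : ∀ᶠ n in 𝒰, ∀ x : Fin (K - 1) → ℝ, δ * (x ⬝ᵥ x) ≤ x ⬝ᵥ ((H n * H n) *ᵥ x))
    {Z : ∀ n, X n → Fin (K - 1) → ℝ} {D : ∀ n, X n → Matrix (Fin (K - 1)) (Fin (K - 1)) ℝ}
    (hZ : ∀ U : Set (Fin (K - 1) → ℝ), IsOpen U → ∀ r < stdNormal (K - 1) U,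
      ∀ᶠ n in 𝒰, r < P n {x | Z n x ∈ U})
    (hD : ∀ ε : ℝ, 0 < ε → Tendsto (fun n => P n {x | ε < frobNorm (D n x)}) 𝒰 (𝓝 0))
    {f : ∀ n, X n → (Fin K → ℝ) → Fin (K - 1) → ℝ}
    {Ω : ∀ n, X n → (Fin K → ℝ) → Matrix (Fin (K - 1)) (Fin (K - 1)) ℝ}
    (hf : ∀ᶠ n : ℕ in 𝒰, ∀ x, Real.sqrt n • f n x (w n) = H n *ᵥ Z n x + B₂ᵀ *ᵥ ν n)
    (hΩ : ∀ᶠ n in 𝒰, ∀ x, H n * H n + D n x = Ω n x (w n))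
    (hΩsymm : ∀ᶠ n in 𝒰, ∀ x, (Ω n x (w n)).IsSymm) {r : ℝ≥0∞}
    (hr : r < ENNReal.ofReal (1 - α)) :
    ∀ᶠ n in 𝒰, r < P n {x | w n ∈ confidenceSet B₂ n α (f n x) (Ω n x)} := by
  obtain ⟨J, I, ν₀, hJ, hJu, hIJ, hν₀nn, hν₀J, hν₀, hνI⟩ := exists_limit_multipliers 𝒰 hw hν
  obtain ⟨H₀, hH₀, hH₀symm, hS₀⟩ := exists_limit_sqrt 𝒰 hsymm hδ hC hδH
  -- The case `K = 0` is excluded by an index with positive weight.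
  have hK : K = K - 1 + 1 := by
    obtain ⟨j, -⟩ : ∃ j, j ∉ J := by
      by_contra h
      push Not at h
      exact hJu (Finset.eq_univ_iff_forall.2 h)
    have := j.pos
    omega
  have hcov := le_stdNormal_iUnion_inRegion (I := I) hK (fun A hA' => hB.rowsIndependent hA')
    hH₀symm hS₀ hJu hIJ hν₀nn hν₀J (q := 1 - α) ⟨by linarith [hα.2], by linarith [hα.1]⟩
  have key := eventually_lt_measure_of_eventually_nhds
    -- Symmetry is a premise inside the event, since neighbourhoods of zero contain nonsymmetric
    -- perturbations; the symmetry of the estimator discharges it.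
    (good := fun n z M => (H n * H n + M).IsSymm → (H n * H n + M).PosDef ∧
      ∃ A ⊆ J, InRegion B₂ (H n * H n + M) J ∅ A (ν n) (reduced B₂ A (ν n) (H n *ᵥ z)) ∧
        sqNorm (H n * H n + M) (activeResidual B₂ A (H n * H n + M)
          (reduced B₂ A (ν n) (H n *ᵥ z))) ≤ chiSqQuantile (max (K - 1 - A.card) 1) (1 - α))
    hZ hD (fun z hz => by
      obtain ⟨A, hIA, hAJ, hreg, hT⟩ := hz
      have hAu : A ≠ Finset.univ := fun h => hJu (Finset.univ_subset_iff.1 (h ▸ hAJ))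
      filter_upwards [eventually_inRegion hH₀ hS₀ (hB.rowsIndependent hAu) hIA hν₀ hνI hreg hT,
        eventually_posDef_add hδ hδH z] with p hp hp' hsymm
      exact ⟨hp' hsymm, A, hAJ, hp⟩) (hr.trans_le hcov)
  filter_upwards [key, hn1, hJ, hw, hf, hΩ, hΩsymm] with n hkey hn hJn hwn hfn hΩn hsn
  refine hkey.trans_le (measure_mono fun x hx => ?_)
  simp only [Set.mem_ofPred_eq, hΩn] at hx
  obtain ⟨hpd, A, hAJ, hreg, hT⟩ := hx (hsn x)
  exact mem_confidenceSet hB hn hwn hpd hJn hAJ (hfn x) hreg hT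

variable {Model : ∀ n, Set (Measure (X n))}
  {Q : ∀ n, Measure (X n) → (Fin K → ℝ) → ℝ}
  {V : ∀ n, Measure (X n) → (Fin K → ℝ) → Matrix (Fin K) (Fin K) ℝ}
  {φ : ∀ n, X n → (Fin K → ℝ) → Fin K → ℝ}
  {Vhat : ∀ n, X n → (Fin K → ℝ) → Matrix (Fin K) (Fin K) ℝ}

theorem measurable_standardised (M : Matrix (Fin m) (Fin m) ℝ) (B : Matrix (Fin K) (Fin m) ℝ)
    (a : ℝ) (b : Fin m → ℝ) : Measurable fun v : Fin K → ℝ => M *ᵥ (a • (Bᵀ *ᵥ v - b)) := by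
  refine Continuous.measurable ?_
  have h1 : Continuous fun v : Fin K → ℝ => Bᵀ *ᵥ v := continuous_const.matrix_mulVec continuous_id
  have h2 : Continuous fun v : Fin m → ℝ => M *ᵥ v := continuous_const.matrix_mulVec continuous_id
  fun_prop

open scoped MatrixOrder in
/-- Asymptotic coverage along a sequence of data distributions and minimisers. -/
theorem eventually_lt_coverage (hB : IsComplement B₂)
    (hModel : ∀ n, 1 ≤ n → ∀ P ∈ Model n, IsProbabilityMeasure P)
    (hQdiff : ∀ n, 1 ≤ n → ∀ P ∈ Model n, Differentiable ℝ (Q n P))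
    (hφmeas : ∀ n, 1 ≤ n → ∀ w ∈ stdSimplex ℝ (Fin K), Measurable fun x => φ n x w)
    (hVsymm : ∀ n, 1 ≤ n → ∀ x, ∀ w ∈ stdSimplex ℝ (Fin K), (Vhat n x w).IsSymm)
    (hA : AsymptoticAssumption B₂ Model Q V φ Vhat) {α : ℝ} (hα : α ∈ Set.Ioo (0 : ℝ) 1)
    {P : ∀ n, Measure (X n)} {w : ℕ → Fin K → ℝ}
    (hPw : ∀ n, 1 ≤ n → P n ∈ Model n ∧ w n ∈ argminSet (Q n (P n)))
    (𝒰 : Ultrafilter ℕ) (h𝒰 : (𝒰 : Filter ℕ) ≤ atTop) {r : ℝ≥0∞}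
    (hr : r < ENNReal.ofReal (1 - α)) :
    ∀ᶠ n in 𝒰, r < P n {x | w n ∈ confidenceSet B₂ n α
      (fun w' => B₂ᵀ *ᵥ φ n x w') (fun w' => B₂ᵀ * Vhat n x w' * B₂)} := by
  have hn1 : ∀ᶠ n in 𝒰, 1 ≤ n := h𝒰 (eventually_ge_atTop 1)
  have hΩ (n : ℕ) (hn : 1 ≤ n) : (B₂ᵀ * V n (P n) (w n) * B₂).PosDef :=
    hA.posDef n hn _ (hPw n hn).1 _ (hPw n hn).2.1
  obtain ⟨C, hC, -⟩ := EReal.lt_iff_exists_real_btwn.1 (hA.bounded P w hPw)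
  obtain ⟨δ, hδ, hδ'⟩ := EReal.lt_iff_exists_real_btwn.1 (hA.nondegenerate P w hPw)
  have hC' : ∀ᶠ n in 𝒰, frobNorm (B₂ᵀ * V n (P n) (w n) * B₂) ^ 2 ≤ C := by
    filter_upwards [h𝒰 (eventually_lt_of_limsup_lt hC)] with n h
    exact (EReal.coe_lt_coe_iff.1 h).le
  have hδΩ : ∀ᶠ n in 𝒰, ∀ x : Fin (K - 1) → ℝ,
      δ * (x ⬝ᵥ x) ≤ x ⬝ᵥ ((B₂ᵀ * V n (P n) (w n) * B₂) *ᵥ x) := by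
    filter_upwards [hn1, h𝒰 (eventually_lt_of_lt_liminf hδ')] with n hn h
    exact le_dotProduct_of_lt_minEigenvalue (hΩ n hn).isHermitian h
  have hHH : ∀ᶠ n in 𝒰, CFC.sqrt (B₂ᵀ * V n (P n) (w n) * B₂) *
      CFC.sqrt (B₂ᵀ * V n (P n) (w n) * B₂) = B₂ᵀ * V n (P n) (w n) * B₂ :=
    hn1.mono fun n hn => sqrt_mul_sqrt (hΩ n hn)
  -- Here `H Z` is the scaled estimation error and `B₂' ν` the scaled population gradient, which add
  -- up to `√n f̂`.
  refine eventually_lt_coverage_of_standardised hB hα 𝒰 hn1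
    (ν := fun n => Real.sqrt n • lagrange (Q n (P n)) (w n))
    (H := fun n => CFC.sqrt (B₂ᵀ * V n (P n) (w n) * B₂))
    (Z := fun n x => invSqrt (B₂ᵀ * V n (P n) (w n) * B₂) *ᵥ
      (Real.sqrt n • (B₂ᵀ *ᵥ φ n x (w n) - B₂ᵀ *ᵥ grad (Q n (P n)) (w n))))
    (D := fun n x => B₂ᵀ * Vhat n x (w n) * B₂ - B₂ᵀ * V n (P n) (w n) * B₂)
    (f := fun n x w' => B₂ᵀ *ᵥ φ n x w') (Ω := fun n x w' => B₂ᵀ * Vhat n x w' * B₂)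
    (hn1.mono fun n hn => (hPw n hn).2.1) ?_ (fun n => transpose_sqrt _)
    (EReal.coe_pos.1 hδ) (C := C) ?_ ?_ ?_ ?_ ?_ ?_ ?_ hr
  · filter_upwards [hn1] with n hn
    have h := lagrange_mem_multipliers (hQdiff n hn _ (hPw n hn).1) (hPw n hn).2
    refine ⟨?_, fun j => mul_nonneg (Real.sqrt_nonneg _) (h.2 j)⟩
    rw [dotProduct_smul, h.1, smul_zero]
  · filter_upwards [hC', hHH] with n h h'
    rwa [h']
  · filter_upwards [hδΩ, hHH] with n h h'
    rwa [h']
  · intro U hU r hr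
    exact h𝒰 (eventually_lt_measure_isOpen (fun n hn => hModel n hn _ (hPw n hn).1)
      (fun n hn => (measurable_standardised _ B₂ _ _).comp (hφmeas n hn _ (hPw n hn).2.1))
      (hA.asymptoticNormality P w hPw) hU hr)
  · exact fun ε hε => (hA.consistent P w (fun n hn => ⟨(hPw n hn).1, (hPw n hn).2.1⟩) ε
      hε).mono_left h𝒰
  · filter_upwards [hn1, hHH] with n hn h x
    have hdet := isUnit_det_of_posDef_mul_self (h.symm ▸ hΩ n hn)
    rw [invSqrt, Matrix.mulVec_mulVec, Matrix.mul_nonsing_inv _ hdet, Matrix.one_mulVec,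
      Matrix.mulVec_smul, hB.mulVec_lagrange, ← smul_add, sub_add_cancel]
  · filter_upwards [hHH] with n h x
    rw [h, add_sub_cancel]
  · filter_upwards [hn1] with n hn x
    rw [Matrix.IsSymm, Matrix.transpose_mul, Matrix.transpose_mul, Matrix.transpose_transpose,
      (hVsymm n hn x _ (hPw n hn).2.1).eq, Matrix.mul_assoc]

end Coverage

end SimplexWeight

theorem theorem1 {K : ℕ} (B₂ : Matrix (Fin K) (Fin (K - 1)) ℝ)
    (hB : SimplexWeight.IsComplement B₂)
    {X : ℕ → Type*} [∀ n, MeasurableSpace (X n)]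
    (Model : ∀ n, Set (Measure (X n)))
    (hModelne : ∀ n, 1 ≤ n → (Model n).Nonempty)
    (hModel : ∀ n, 1 ≤ n → ∀ P ∈ Model n, IsProbabilityMeasure P)
    (Q : ∀ n, Measure (X n) → (Fin K → ℝ) → ℝ)
    (hQconv : ∀ n, 1 ≤ n → ∀ P ∈ Model n, ConvexOn ℝ Set.univ (Q n P))
    (hQdiff : ∀ n, 1 ≤ n → ∀ P ∈ Model n, Differentiable ℝ (Q n P))
    (V : ∀ n, Measure (X n) → (Fin K → ℝ) → Matrix (Fin K) (Fin K) ℝ)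
    (φ : ∀ n, X n → (Fin K → ℝ) → Fin K → ℝ)
    (Vhat : ∀ n, X n → (Fin K → ℝ) → Matrix (Fin K) (Fin K) ℝ)
    (hφmeas : ∀ n, 1 ≤ n → ∀ w ∈ stdSimplex ℝ (Fin K), Measurable fun x => φ n x w)
    (hVmeas : ∀ n, 1 ≤ n → ∀ w ∈ stdSimplex ℝ (Fin K), ∀ i j, Measurable fun x => Vhat n x w i j)
    (hVsymm : ∀ n, 1 ≤ n → ∀ x, ∀ w ∈ stdSimplex ℝ (Fin K), (Vhat n x w).IsSymm)
    (hA : SimplexWeight.AsymptoticAssumption B₂ Model Q V φ Vhat)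
    (α : ℝ) (hα : α ∈ Set.Ioo (0 : ℝ) 1) :
    ENNReal.ofReal (1 - α) ≤
      liminf (fun n => ⨅ P ∈ Model n, ⨅ w ∈ SimplexWeight.argminSet (Q n P),
        P {x | w ∈ SimplexWeight.confidenceSet B₂ n α
          (fun w' => B₂ᵀ *ᵥ φ n x w') (fun w' => B₂ᵀ * Vhat n x w' * B₂)}) atTop := by
  by_contra hcon
  obtain ⟨r, hr, hrα⟩ := exists_between (not_le.1 hcon)
  have hfreq := (frequently_lt_of_liminf_lt (by isBoundedDefault) hr).and_eventually
    (eventually_ge_atTop 1)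
  set bad : ℕ → Prop := fun n => (⨅ P ∈ Model n, ⨅ w ∈ SimplexWeight.argminSet (Q n P),
        P {x | w ∈ SimplexWeight.confidenceSet B₂ n α
          (fun w' => B₂ᵀ *ᵥ φ n x w') (fun w' => B₂ᵀ * Vhat n x w' * B₂)}) < r ∧ 1 ≤ n with hbad
  have hwit (n : ℕ) (hn : bad n) : ∃ P ∈ Model n, ∃ w ∈ SimplexWeight.argminSet (Q n P),
      P {x | w ∈ SimplexWeight.confidenceSet B₂ n α
        (fun w' => B₂ᵀ *ᵥ φ n x w') (fun w' => B₂ᵀ * Vhat n x w' * B₂)} < r := by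
    obtain ⟨P, hP⟩ := iInf_lt_iff.1 hn.1
    obtain ⟨hPM, hP⟩ := iInf_lt_iff.1 hP
    obtain ⟨w, hw⟩ := iInf_lt_iff.1 hP
    obtain ⟨hwQ, hw⟩ := iInf_lt_iff.1 hw
    exact ⟨P, hPM, w, hwQ, hw⟩
  have hne : (stdSimplex ℝ (Fin K)).Nonempty := by
    obtain ⟨n, hn⟩ := hfreq.exists
    obtain ⟨P, -, w, hw, -⟩ := hwit n hn
    exact ⟨w, hw.1⟩
  -- The assumptions concern full sequences, so the bad sample sizes are filled up with an arbitrary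
  -- model and minimiser elsewhere, and with zero at `n = 0`.
  have hseq (n : ℕ) : ∃ (P : Measure (X n)) (w : Fin K → ℝ),
      (1 ≤ n → P ∈ Model n ∧ w ∈ SimplexWeight.argminSet (Q n P)) ∧
      (bad n → P {x | w ∈ SimplexWeight.confidenceSet B₂ n α
        (fun w' => B₂ᵀ *ᵥ φ n x w') (fun w' => B₂ᵀ * Vhat n x w' * B₂)} < r) := by
    by_cases hb : bad n
    · obtain ⟨P, hP, w, hw, h⟩ := hwit n hb
      exact ⟨P, w, fun _ => ⟨hP, hw⟩, fun _ => h⟩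
    by_cases hn : 1 ≤ n
    · obtain ⟨P, hP⟩ := hModelne n hn
      obtain ⟨w, hw⟩ := SimplexWeight.argminSet_nonempty (hQdiff n hn P hP).continuous hne
      exact ⟨P, w, fun _ => ⟨hP, hw⟩, fun h => absurd h hb⟩
    · exact ⟨0, 0, fun h => absurd h hn, fun h => absurd h hb⟩
  choose P w hPw hPbad using hseq
  -- An ultrafilter containing the bad sample sizes plays the role of a subsequence along which all
  -- required limits exist.
  have : NeBot (atTop ⊓ 𝓟 {n | bad n}) := frequently_iff_neBot.1 hfreq
  have h𝒰 := Ultrafilter.of_le (atTop ⊓ 𝓟 {n | bad n})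
  have hgood := SimplexWeight.eventually_lt_coverage hB hModel hQdiff hφmeas hVsymm hA hα hPw
    (Ultrafilter.of (atTop ⊓ 𝓟 {n | bad n})) (h𝒰.trans inf_le_left) hrα
  have hb : ∀ᶠ n in (Ultrafilter.of (atTop ⊓ 𝓟 {n | bad n}) : Filter ℕ), bad n :=
    (h𝒰.trans inf_le_right) (mem_principal_self _)
  obtain ⟨n, h1, h2⟩ := (hgood.and hb).exists
  exact lt_asymm h1 (hPbad n h2)
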